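/- All graphs are finite and simple. Let $G$ be a graph with chromatic number $k=\chi(G)$. A permutation of a proper $k$-colouring $f:V(G)\to\{1,\dots,k\}$ is a colouring $c=f\circ\sigma$ with $\sigma$ a permutation of $V(G)$. For such a $c$, let $B(c)$ be the least number of vertices $v$ with $g(v)\neq c(v)$, taken over all proper $k$-colourings $g:V(G)\to\{1,\dots,k\}$ of $G$ that use each colour exactly as many times as $c$ does. The villainy of $G$ is $B(G)=\max_c B(c)$, the maximum over all permutations $c$ of proper $k$-colourings of $G$. Write $G+H$ for the disjoint union of $G$ and $H$, $rK_1$ for $r$ isolated vertices, and $K_n$, $P_n$, $C_n$ for the complete graph, path and cycle on $n$ vertices. Theorem. If $B(G)=2$, then, up to isomorphism, $G$ is one of the following graphs: 1. $K_{1,t}$ for some $t\geq 2$; 2. a connected bipartite graph on 6 vertices with both parts of size 3; 3. $P_4$, $P_4+K_1$ or $P_4+K_2$; 4. $C_4$, $C_4+K_1$ or $C_4+K_2$; 5. $C_5$; 6. $K_2+K_2$ or $K_2+K_2+K_2$; 7. $K_3+K_2$; 8. $K_3+K_3$; 9. $K_2+K_2+K_1$; 10. a graph of order at least 4 with a vertex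 $v$ of degree 0 or 1 such that $G-v$ is a complete graph; 11. $P_3+rK_1$ for some $r\geq 1$; 12. $K_2+rK_1$ for some $r\geq 1$. -/

import Mathlib

/-- Two colourings use every colour the same number of times. -/
def SameMultiplicities {V : Type*} {k : ℕ} (c d : V → Fin k) : Prop :=
  ∀ i : Fin k, {v | c v = i}.ncard = {v | d v = i}.ncard

/-- The numbers of vertices that are recoloured when the colouring `c`, which need not be
proper, is turned into a proper colouring of `G` with the same colour multiplicities. -/
def recoloringCosts {V : Type*} (G : SimpleGraph V) {k : ℕ} (c : V → Fin k) : Set ℕ :=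
  {m | ∃ g : G.Coloring (Fin k), SameMultiplicities (fun v => g v) c ∧
    m = {v | g v ≠ c v}.ncard}

/-- The villainy `B(c)` of a colouring `c`: the least number of vertices that must be recoloured
to get a proper colouring with the same colour multiplicities. -/
noncomputable def coloringVillainy {V : Type*} (G : SimpleGraph V) {k : ℕ} (c : V → Fin k) : ℕ :=
  sInf (recoloringCosts G c)

/-- The villainies of all permutations `f ∘ σ` of proper colourings `f` of `G` with exactly
`χ(G)` available colours. -/
noncomputable def villainySet {V : Type*} (G : SimpleGraph V) : Set ℕ :=
  {m | ∃ (f : G.Coloring (Fin G.chromaticNumber.toNat)) (σ : Equiv.Perm V),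
    m = coloringVillainy G (fun v => f (σ v))}

/-- The villainy `B(G)` of a finite graph `G`: the maximum of the villainies of all permutations
of optimal proper colourings of `G`. -/
noncomputable def villainy {V : Type*} (G : SimpleGraph V) : ℕ :=
  sSup (villainySet G)

/-- For a finite graph the infimum in the villainy of a permuted proper colouring is attained. -/
theorem coloringVillainy_isLeast {V : Type*} [Finite V] (G : SimpleGraph V) {k : ℕ}
    (f : G.Coloring (Fin k)) (σ : Equiv.Perm V) :
    IsLeast (recoloringCosts G (fun v => f (σ v))) (coloringVillainy G (fun v => f (σ v))) := by
  have hne : (recoloringCosts G (fun v => f (σ v))).Nonempty := by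
    refine ⟨_, f, fun i => ?_, rfl⟩
    have h : {v | f (σ v) = i} = σ ⁻¹' {v | f v = i} := rfl
    rw [h, ← Equiv.image_symm_eq_preimage, Set.ncard_image_of_injective _ σ.symm.injective]
  exact ⟨Nat.sInf_mem hne, fun m hm => Nat.sInf_le hm⟩

/-- For a finite graph the supremum in the definition of `villainy` is a maximum. -/
theorem villainy_isGreatest {V : Type*} [Finite V] (G : SimpleGraph V) :
    IsGreatest (villainySet G) (villainy G) := by
  have hbdd : BddAbove (villainySet G) := by
    refine ⟨Nat.card V, ?_⟩
    rintro m ⟨f, σ, rfl⟩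
    obtain ⟨g, -, hg⟩ := (coloringVillainy_isLeast G f σ).1
    rw [hg]
    exact Set.ncard_le_card _
  have hcol : G.Colorable G.chromaticNumber.toNat := by
    obtain ⟨n, hn⟩ : ∃ n, G.Colorable n := by
      have := Fintype.ofFinite V
      exact ⟨_, G.colorable_of_fintype⟩
    exact SimpleGraph.colorable_chromaticNumber hn
  obtain ⟨f⟩ := hcol
  exact ⟨Nat.sSup_mem ⟨_, f, 1, rfl⟩ hbdd, fun m hm => le_csSup hbdd hm⟩

/-! Let `k = χ(G)`. A repair that changes at most two vertices and keeps the multiplicities is an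
exchange of two colours or nothing. So villainy 2 gives `OneSwap`: however the colours of a proper
`k`-colouring are shuffled, one exchange makes the result proper. Nonzero villainy supplies an edge
and a colour used twice. The other tool is `AllSurjective`: a proper colouring with `k` colours can
never be turned into one that misses a colour.

`OneSwap` is exploited by placing repeated colours on edges. A colour used four times excludes two
disjoint edges, a colour used three times excludes triangles, and three colours used twice exclude
three disjoint edges. Two colours used twice force non-edges between any two disjoint edges.

If some proper colouring uses a colour four times, all edges meet in one vertex, so `k = 2` and
`star_case` applies. Otherwise every class has at most three vertices. For `k = 2` this leaves at
most six vertices, and the pairs of class sizes are treated separately.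

For `k ≥ 3`, suppose no proper colouring repeats two colours. Then the vertices of singleton classes
form a clique, and recolouring shows that the graph is complete up to one vertex of degree at most
one (`almost_complete`). If two colours are repeated and there is a triangle, that triangle is a
component and the rest is a clique of two or three vertices (`triangle_case`). If there is no
triangle, the non-bipartite graph is shown to have five vertices, and non-bipartiteness forces all
edges of a 5-cycle (`triangle_free_case`). -/

section OneSwap

variable {V : Type*} {G : SimpleGraph V} {k : ℕ}

/-! ### The exchange property and the configurations it excludes. -/

/-- The endpoints of every edge get different values. -/
def IsProper {α : Type*} (G : SimpleGraph V) (f : V → α) : Prop :=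
  ∀ ⦃u v⦄, G.Adj u v → f u ≠ f v

/-- Every permutation of a proper `k`-colouring becomes proper after exchanging the colours of at
most one pair of vertices. -/
def OneSwap (G : SimpleGraph V) (k : ℕ) : Prop :=
  ∀ f : V → Fin k, IsProper G f → ∀ σ : Equiv.Perm V, ∃ (x y : V) (d : V → Fin k),
    d x = f (σ y) ∧ d y = f (σ x) ∧ (∀ w, w = x ∨ w = y ∨ d w = f (σ w)) ∧ IsProper G d

/-- Every proper `k`-colouring uses all colours. -/
def AllSurjective (G : SimpleGraph V) (k : ℕ) : Prop :=
  ∀ f : V → Fin k, IsProper G f → Function.Surjective f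

/-- The symmetric group is multiply transitive. This is what allows a pattern of colours to be
prescribed on a few chosen vertices. -/
theorem exists_perm_extending (L : List (V × V)) (h₁ : (L.map Prod.fst).Nodup)
    (h₂ : (L.map Prod.snd).Nodup) : ∃ σ : Equiv.Perm V, ∀ p ∈ L, σ p.1 = p.2 := by
  have := Equiv.Perm.isMultiplyPretransitive V L.length
  have key : ∀ g : V × V → V, (L.map g).Nodup →
      Function.Injective (fun i : Fin L.length => g L[i]) := by
    intro g hg i j hij
    have := (List.Nodup.getElem_inj_iff hg (i := i) (j := j) (hi := by simp) (hj := by simp)).1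
      (by simpa using hij)
    exact Fin.ext this
  obtain ⟨σ, hσ⟩ := this.exists_smul_eq ⟨_, key _ h₁⟩ ⟨_, key _ h₂⟩
  refine ⟨σ, fun p hp => ?_⟩
  obtain ⟨i, hi, rfl⟩ := List.getElem_of_mem hp
  exact congrArg (fun e : Fin L.length ↪ V => e ⟨i, hi⟩) hσ

/-- A proper colouring can be permuted so that prescribed vertices get the colours of other
prescribed vertices. -/
theorem OneSwap.exists_swap (h : OneSwap G k) {f : V → Fin k} (hf : IsProper G f)
    (L : List (V × V)) (h₁ : (L.map Prod.fst).Nodup) (h₂ : (L.map Prod.snd).Nodup) :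
    ∃ (c d : V → Fin k) (x y : V), (∀ p ∈ L, c p.1 = f p.2) ∧ d x = c y ∧ d y = c x ∧
      (∀ w, w = x ∨ w = y ∨ d w = c w) ∧ IsProper G d := by
  obtain ⟨σ, hσ⟩ := exists_perm_extending L h₁ h₂
  obtain ⟨x, y, d, h1, h2, h3, h4⟩ := h f hf σ
  exact ⟨fun v => f (σ v), d, x, y, fun p hp => by simp [hσ p hp], h1, h2, h3, h4⟩

/-- A colour used four times excludes two disjoint edges. -/
theorem OneSwap.no_two_matching (h : OneSwap G k) {f : V → Fin k} (hf : IsProper G f)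
    {p q r s : V} (hn : [p, q, r, s].Nodup) (h1 : f p = f q) (h2 : f p = f r) (h3 : f p = f s)
    {a b c d : V} (hm : [a, b, c, d].Nodup) (hab : G.Adj a b) (hcd : G.Adj c d) : False := by
  -- All four ends carry one colour, so an exchange alters at most one of them and an edge stays
  -- monochromatic.
  obtain ⟨C, D, x, y, hC, hx, hy, hw, hD⟩ :=
    h.exists_swap hf [(a, p), (b, q), (c, r), (d, s)] hm hn
  simp at hC hm
  have e1 := hD hab
  have e2 := hD hcd
  clear hn
  grind

/-- A colour used three times excludes triangles. -/
theorem OneSwap.no_triangle (h : OneSwap G k) {f : V → Fin k} (hf : IsProper G f)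
    {p q r : V} (hn : [p, q, r].Nodup) (h1 : f p = f q) (h2 : f p = f r)
    {a b c : V} (hab : G.Adj a b) (hac : G.Adj a c) (hbc : G.Adj b c) : False := by
  obtain ⟨C, D, x, y, hC, hx, hy, hw, hD⟩ :=
    h.exists_swap hf [(a, p), (b, q), (c, r)] (by simp [hab.ne, hac.ne, hbc.ne]) hn
  simp at hC
  have := hD hab
  have := hD hac
  have := hD hbc
  clear hn
  grind

/-- Three colours used twice exclude three disjoint edges. -/
theorem OneSwap.no_three_matching (h : OneSwap G k) {f : V → Fin k} (hf : IsProper G f)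
    {p p' q q' r r' : V} (hp : p ≠ p') (hq : q ≠ q') (hr : r ≠ r') (h1 : f p = f p')
    (h2 : f q = f q') (h3 : f r = f r') (hpq : f p ≠ f q) (hpr : f p ≠ f r) (hqr : f q ≠ f r)
    {a a' b b' c c' : V} (hm : [a, a', b, b', c, c'].Nodup)
    (ha : G.Adj a a') (hb : G.Adj b b') (hc : G.Adj c c') : False := by
  -- An exchange touches at most two vertices and misses one of three monochromatic edges.
  obtain ⟨C, D, x, y, hC, hx, hy, hw, hD⟩ :=
    h.exists_swap hf [(a, p), (a', p'), (b, q), (b', q'), (c, r), (c', r')] hm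
      (by simp; grind (splits := 40))
  simp at hC hm
  have := hD ha
  have := hD hb
  have := hD hc
  grind

/-- Two colours used twice: two disjoint edges leave a perfect matching of non-edges between
them. -/
theorem OneSwap.cross_nonadj (h : OneSwap G k) {f : V → Fin k} (hf : IsProper G f)
    {p p' q q' : V} (hp : p ≠ p') (hq : q ≠ q') (h1 : f p = f p') (h2 : f q = f q')
    (hpq : f p ≠ f q) {a a' b b' : V} (hm : [a, a', b, b'].Nodup)
    (ha : G.Adj a a') (hb : G.Adj b b') :
    (¬ G.Adj a b ∧ ¬ G.Adj a' b') ∨ (¬ G.Adj a b' ∧ ¬ G.Adj a' b) := by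
  -- Repairing both edges means exchanging an end of one with an end of the other. Each moved vertex
  -- then shares its colour with the unmoved end of the other edge.
  obtain ⟨C, D, x, y, hC, hx, hy, hw, hD⟩ :=
    h.exists_swap hf [(a, p), (a', p'), (b, q), (b', q')] hm (by simp; grind)
  simp at hC hm
  have := hD ha
  have := hD hb
  have := @hD a b
  have := @hD a' b'
  have := @hD a b'
  have := @hD a' b
  grind

/-- A colour used three times and another one used twice exclude a cycle of length five. -/
theorem OneSwap.no_five_cycle (h : OneSwap G k) {f : V → Fin k} (hf : IsProper G f)
    {p q r s t : V} (hn : [p, q, r].Nodup) (hst : s ≠ t) (h1 : f p = f q) (h2 : f p = f r)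
    (h3 : f s = f t) (hps : f p ≠ f s)
    {a b c d e : V} (hm : [a, b, c, d, e].Nodup) (hab : G.Adj a b) (hbc : G.Adj b c)
    (hcd : G.Adj c d) (hde : G.Adj d e) (hea : G.Adj e a) : False := by
  -- Repairing `ab`, `bc` and `de` requires exchanging `b` with `d` or `e`, which makes `cd` or `ea`
  -- monochromatic.
  obtain ⟨C, D, x, y, hC, hx, hy, hw, hD⟩ :=
    h.exists_swap hf [(a, p), (b, q), (c, r), (d, s), (e, t)] hm (by simp at hn ⊢; grind)
  simp at hC hm
  have := hD hab
  have := hD hbc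
  have := hD hcd
  have := hD hde
  have := hD hea
  clear hn
  grind

/-! ### Consequences of using all colours, and 5-cycles in triangle-free graphs. -/

/-- No three vertices are pairwise adjacent. -/
def NoTriangle (G : SimpleGraph V) : Prop :=
  ∀ ⦃a b c⦄, G.Adj a b → G.Adj a c → G.Adj b c → False

/-- No three edges are pairwise disjoint. -/
def NoThreeMatching (G : SimpleGraph V) : Prop :=
  ∀ ⦃a a' b b' c c'⦄, [a, a', b, b', c, c'].Nodup → G.Adj a a' → G.Adj b b' → G.Adj c c' → False

/-- Two classes without an edge between them could be merged, which frees a colour. -/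
theorem AllSurjective.exists_adj (hs : AllSurjective G k) {f : V → Fin k} (hf : IsProper G f)
    {i j : Fin k} (hij : i ≠ j) : ∃ u v, G.Adj u v ∧ f u = i ∧ f v = j := by
  classical
  by_contra! hc
  obtain ⟨w, hw⟩ := hs (fun w => if f w = j then i else f w) (by
    intro u v huv
    have := hf huv
    have := hc u v huv
    have := hc v u huv.symm
    grind) j
  grind

theorem AllSurjective.not_bipartite (hs : AllSurjective G k) (hk : 3 ≤ k) (S : V → Prop)
    (hS : ∀ ⦃u v⦄, G.Adj u v → (S u ↔ ¬ S v)) : False := by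
  classical
  obtain ⟨w, hw⟩ := hs (fun w => if S w then ⟨0, by omega⟩ else ⟨1, by omega⟩) (by
    intro u v huv
    have := hS huv
    grind) ⟨2, by omega⟩
  grind

theorem exists_third {k : ℕ} (hk : 3 ≤ k) (i j : Fin k) : ∃ l : Fin k, l ≠ i ∧ l ≠ j := by
  have : ({i, j} : Finset (Fin k)).card < Fintype.card (Fin k) := by
    have := Finset.card_le_two (a := i) (b := j)
    simp; omega
  obtain ⟨l, hl⟩ := Finset.exists_mem_notMem_of_card_lt_card (s := {i, j}) (t := Finset.univ)
    (by simpa using this)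
  simp at hl
  exact ⟨l, hl⟩

/-- A vertex that is alone in its class has a non-neighbour in each other class. -/
theorem AllSurjective.exists_not_adj (hs : AllSurjective G k) (hT : NoTriangle G) (hk : 3 ≤ k)
    {f : V → Fin k} (hf : IsProper G f) {u : V} (hu : ∀ w, f w = f u → w = u) {i : Fin k}
    (hi : i ≠ f u) : ∃ a, f a = i ∧ ¬ G.Adj u a := by
  classical
  by_contra! hc
  obtain ⟨l, hl, hl'⟩ := exists_third hk i (f u)
  -- The neighbourhood of `u` is independent and contains class `i`. So it can all take colour `i`
  -- and `u` a third colour, which leaves `f u` unused.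
  obtain ⟨w, hw⟩ := hs (fun w => if G.Adj u w then i else if w = u then l else f w) (by
    intro x y hxy
    have h1 := hf hxy
    have h2 := @hT u x y
    have h3 := hc x
    have h4 := hc y
    by_cases hx : G.Adj u x <;> by_cases hy : G.Adj u y <;> by_cases hxu : x = u <;>
      by_cases hyu : y = u <;> simp_all [G.adj_comm] <;> grind) (f u)
  grind

/-- Without triangles two colour classes are never both singletons. -/
theorem AllSurjective.not_two_singletons (hs : AllSurjective G k) (hT : NoTriangle G)
    (hk : 3 ≤ k) {f : V → Fin k} (hf : IsProper G f) {u v : V} (huv : u ≠ v)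
    (hu : ∀ w, f w = f u → w = u) (hv : ∀ w, f w = f v → w = v) : False := by
  have hne : f v ≠ f u := fun h => huv (hu _ h).symm
  obtain ⟨a, ha, ha'⟩ := hs.exists_not_adj hT hk hf hu hne
  obtain ⟨x, y, hxy, hx, hy⟩ := hs.exists_adj hf hne.symm
  rw [hu x hx, hv y hy] at hxy
  exact ha' (hv a ha ▸ hxy)

/-- A graph without triangles and without two disjoint edges is a star with isolated vertices. -/
theorem exists_center (hT : NoTriangle G)
    (hM : ∀ ⦃a b c d⦄, [a, b, c, d].Nodup → G.Adj a b → G.Adj c d → False)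
    {x y : V} (hxy : G.Adj x y) : ∃ v, ∀ ⦃a b⦄, G.Adj a b → a = v ∨ b = v := by
  by_contra! hc
  obtain ⟨a, b, hab, ha, hb⟩ := hc x
  obtain ⟨c, d, hcd, hc, hd⟩ := hc y
  have h1 : a = y ∨ b = y := by
    by_contra! h
    exact hM (a := x) (b := y) (c := a) (d := b)
      (by simp [hxy.ne, hab.ne, ha.symm, hb.symm, h.1.symm, h.2.symm]) hxy hab
  have h2 : c = x ∨ d = x := by
    by_contra! h
    exact hM (a := x) (b := y) (c := c) (d := d)
      (by simp [hxy.ne, hcd.ne, hc.symm, hd.symm, h.1.symm, h.2.symm]) hxy hcd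
  obtain ⟨z, hz, hzx⟩ : ∃ z, G.Adj y z ∧ z ≠ x := by
    rcases h1 with rfl | rfl
    · exact ⟨b, hab, hb⟩
    · exact ⟨a, hab.symm, ha⟩
  obtain ⟨w, hw, hwy⟩ : ∃ w, G.Adj x w ∧ w ≠ y := by
    rcases h2 with rfl | rfl
    · exact ⟨d, hcd, hd⟩
    · exact ⟨c, hcd.symm, hc⟩
  by_cases h : z = w
  · exact hT hxy (h ▸ hw) hz
  · exact hM (a := y) (b := z) (c := x) (d := w)
      (by simp [hz.ne, hw.ne, hzx, hwy.symm, h, hxy.ne']) hz hw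

/-- A non-bipartite graph without triangles and without three disjoint edges contains a cycle of
length five. -/
theorem exists_five_cycle (hT : NoTriangle G) (hM : NoThreeMatching G)
    (hB : ∀ S : V → Prop, ¬ ∀ ⦃u v⦄, G.Adj u v → (S u ↔ ¬ S v)) :
    ∃ a b c d e, [a, b, c, d, e].Nodup ∧ G.Adj a b ∧ G.Adj b c ∧ G.Adj c d ∧ G.Adj d e ∧
      G.Adj e a := by
  obtain ⟨x, x', y, y', hn, hx, hy⟩ : ∃ x x' y y', [x, x', y, y'].Nodup ∧ G.Adj x x' ∧
      G.Adj y y' := by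
    by_contra! hc
    obtain ⟨u, v, huv⟩ : ∃ u v, G.Adj u v := by
      by_contra! h
      exact hB (fun _ => True) fun u v huv => (h u v huv).elim
    obtain ⟨v, hv⟩ := exists_center hT (fun a b c d h1 h2 h3 => hc a b c d h1 h2 h3) huv
    refine hB (fun w => w = v) fun a b hab => ?_
    have := hv hab
    have := hab.ne
    grind
  simp only [List.nodup_cons, List.mem_cons, List.not_mem_nil, not_or, or_false, not_false_eq_true,
    List.nodup_nil, and_true] at hn
  have hR : ∀ ⦃u v⦄, G.Adj u v → (u = x ∨ u = x' ∨ u = y ∨ u = y') ∨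
      (v = x ∨ v = x' ∨ v = y ∨ v = y') := by
    intro u v huv
    by_contra! h
    have := huv.ne
    exact hM (a := x) (a' := x') (b := y) (b' := y') (c := u) (c' := v) (by simp; grind) hx hy huv
  -- If both ends of `xx'` had neighbours outside the four vertices, these would give a triangle or
  -- three disjoint edges.
  have one_side : ∀ {x x' y y' : V}, (x ≠ x' ∧ x ≠ y ∧ x ≠ y') ∧ (x' ≠ y ∧ x' ≠ y') ∧ y ≠ y' →
      G.Adj x x' → G.Adj y y' →
      (∀ w, G.Adj x w → w = x ∨ w = x' ∨ w = y ∨ w = y') ∨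
      (∀ w, G.Adj x' w → w = x ∨ w = x' ∨ w = y ∨ w = y') := by
    intro x x' y y' hn hx hy
    by_contra! h
    obtain ⟨⟨v, hv, hv'⟩, w, hw, hw'⟩ := h
    by_cases hvw : v = w
    · exact hT hx hv (hvw ▸ hw)
    · exact hM (a := x) (a' := v) (b := x') (b' := w) (c := y) (c' := y') (by simp; grind) hv hw hy
  -- Name the ends so that only `x` and `y` may have outside neighbours. Every edge other than
  -- `x'y'` then meets `x` or `y`, and a bipartition can be written down unless `x` and `y` have a
  -- common neighbour closing a 5-cycle through `x'y'`.
  have main : ∀ {x x' y y' : V}, (x ≠ x' ∧ x ≠ y ∧ x ≠ y') ∧ (x' ≠ y ∧ x' ≠ y') ∧ y ≠ y' →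
      G.Adj x x' → G.Adj y y' → (∀ ⦃u v⦄, G.Adj u v → (u = x ∨ u = x' ∨ u = y ∨ u = y') ∨
      (v = x ∨ v = x' ∨ v = y ∨ v = y')) →
      (∀ w, G.Adj x' w → w = x ∨ w = x' ∨ w = y ∨ w = y') →
      (∀ w, G.Adj y' w → w = x ∨ w = x' ∨ w = y ∨ w = y') →
      ∃ a b c d e, [a, b, c, d, e].Nodup ∧ G.Adj a b ∧ G.Adj b c ∧ G.Adj c d ∧ G.Adj d e ∧
      G.Adj e a := by
    intro x x' y y' hn hx hy hR hx' hy'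
    by_contra! hno
    have hcover : ∀ ⦃u v⦄, G.Adj u v → (u = x ∨ u = y ∨ v = x ∨ v = y) ∨ (u = x' ∧ v = y') ∨
        (u = y' ∧ v = x') := by
      intro u v huv
      have := huv.ne
      have h1 := hx' u
      have h2 := hx' v
      have h3 := hy' u
      have h4 := hy' v
      have h5 := huv.symm
      rcases hR huv with (rfl | rfl | rfl | rfl) | (rfl | rfl | rfl | rfl) <;> grind
    by_cases hxy : G.Adj x y
    · refine hB (fun w => G.Adj y w) fun u v huv => ?_
      have hx'y : ¬ G.Adj x' y := fun h => hT hx hxy h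
      have hxy' : ¬ G.Adj x y' := fun h => hT hxy h hy
      rcases hcover huv with (rfl | rfl | rfl | rfl) | ⟨rfl, rfl⟩ | ⟨rfl, rfl⟩
      · have : ¬ G.Adj y v := fun h => hT hxy huv h
        simp [hxy.symm, this]
      · simp [huv]
      · have : ¬ G.Adj y u := fun h => hT hxy huv.symm h
        simp [hxy.symm, this]
      · simp [huv.symm]
      · simp [G.adj_comm y, hx'y, hy.symm]
      · simp [G.adj_comm y, hx'y, hy.symm]
    by_cases hxy' : G.Adj x' y'
    · have h1 : ¬ G.Adj x y' := fun h => hT hx h hxy'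
      have h2 : ¬ G.Adj x' y := fun h => hT h hxy' hy
      refine hB (fun w => w = x ∨ G.Adj y w) fun u v huv => ?_
      have hcom : ∀ r, G.Adj x r → G.Adj y r → False := by
        intro r hr hr'
        have hrx : r ≠ x' := by rintro rfl; exact h2 hr'.symm
        have hry : r ≠ y' := by rintro rfl; exact h1 hr
        have := hr.ne
        have := hr'.ne
        exact hno x x' y' y r (by simp; grind) hx hxy' hy.symm hr' hr.symm
      rcases hcover huv with (rfl | rfl | rfl | rfl) | ⟨rfl, rfl⟩ | ⟨rfl, rfl⟩
      · have := hcom v huv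
        have := huv.ne
        grind
      · have : v ≠ x := by rintro rfl; exact hxy huv.symm
        simp [huv, this]
        grind
      · have := hcom u huv.symm
        have := huv.ne
        grind
      · have : u ≠ x := by rintro rfl; exact hxy huv
        simp [huv.symm, this]
        grind
      · simp [G.adj_comm y, h2, hy.symm]; grind
      · simp [G.adj_comm y, h2, hy.symm]; grind
    · refine hB (fun w => w = x ∨ w = y) fun u v huv => ?_
      have := huv.ne
      have := huv.symm
      have := hcover huv
      grind
  rcases one_side hn hx hy with h1 | h1 <;>
    rcases one_side (x := y) (x' := y') (y := x) (y' := x') (by grind) hy hx with h2 | h2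
  · exact main (x := x') (x' := x) (y := y') (y' := y) (by grind) hx.symm hy.symm
      (fun u v huv => by have := hR huv; grind) (by grind) (by grind)
  · exact main (x := x') (x' := x) (y := y) (y' := y') (by grind) hx.symm hy
      (fun u v huv => by have := hR huv; grind) (by grind) (by grind)
  · exact main (x := x) (x' := x') (y := y') (y' := y) (by grind) hx hy.symm
      (fun u v huv => by have := hR huv; grind) (by grind) (by grind)
  · exact main (x := x) (x' := x') (y := y) (y' := y') (by grind) hx hy
      (fun u v huv => by have := hR huv; grind) (by grind) (by grind)

/-! ### Isomorphisms assembled from embeddings of pieces. -/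

/-- An embedding onto all vertices is an isomorphism. -/
theorem nonempty_iso_of_surjective {W : Type*} {H : SimpleGraph W} (e : H ↪g G)
    (he : ∀ v, v ∈ Set.range e) : Nonempty (G ≃g H) :=
  ⟨(RelIso.ofSurjective e he).symm⟩

theorem exists_embedding {W : Type*} {H : SimpleGraph W} (e : W → V) (he : e.Injective)
    (hadj : ∀ a b, G.Adj (e a) (e b) ↔ H.Adj a b) : ∃ e' : H ↪g G, Set.range e' = Set.range e :=
  ⟨⟨⟨e, he⟩, hadj _ _⟩, rfl⟩

/-- Two embeddings that split the vertices, without edges between their images, exhibit the graph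
as a disjoint union. -/
theorem nonempty_iso_sum {W₁ W₂ : Type*} {H₁ : SimpleGraph W₁} {H₂ : SimpleGraph W₂}
    (e₁ : H₁ ↪g G) (e₂ : H₂ ↪g G) (hne : ∀ x ∈ Set.range e₁, ∀ y ∈ Set.range e₂, x ≠ y)
    (hadj : ∀ x ∈ Set.range e₁, ∀ y ∈ Set.range e₂, ¬ G.Adj x y)
    (hcov : ∀ v, v ∈ Set.range e₁ ∨ v ∈ Set.range e₂) : Nonempty (G ≃g (H₁ ⊕g H₂)) := by
  obtain ⟨e, he⟩ := exists_embedding (G := G) (H := H₁ ⊕g H₂) (Sum.elim e₁ e₂) (by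
    rintro (a | a) (b | b) hab
    · simpa using hab
    · exact (hne _ ⟨a, rfl⟩ _ ⟨b, rfl⟩ hab).elim
    · exact (hne _ ⟨b, rfl⟩ _ ⟨a, rfl⟩ hab.symm).elim
    · simpa using hab) (by
    rintro (a | a) (b | b)
    · simp
    · simpa using hadj _ ⟨a, rfl⟩ _ ⟨b, rfl⟩
    · simpa using fun h => hadj _ ⟨b, rfl⟩ _ ⟨a, rfl⟩ (G.adj_symm h)
    · simp)
  refine nonempty_iso_of_surjective e fun v => ?_
  rw [he]
  simpa using hcov v

theorem exists_embedding_complete_one (a : V) :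
    ∃ e : SimpleGraph.completeGraph (Fin 1) ↪g G, Set.range e = {a} := by
  obtain ⟨e, he⟩ := exists_embedding (G := G) (H := SimpleGraph.completeGraph (Fin 1)) ![a]
    (fun _ _ _ => Subsingleton.elim _ _) (by intro i j; simp [Subsingleton.elim i j])
  exact ⟨e, he.trans (by simp)⟩

theorem exists_embedding_complete_two {a b : V} (hab : G.Adj a b) :
    ∃ e : SimpleGraph.completeGraph (Fin 2) ↪g G, Set.range e = {a, b} := by
  have := hab.ne
  obtain ⟨e, he⟩ := exists_embedding (G := G) (H := SimpleGraph.completeGraph (Fin 2)) ![a, b]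
    (by intro i j; fin_cases i <;> fin_cases j <;> simp <;> grind)
    (by intro i j; fin_cases i <;> fin_cases j <;> simp [hab, hab.symm])
  exact ⟨e, he.trans (Matrix.range_cons_cons_empty _ _ _)⟩

theorem exists_embedding_complete_three {a b c : V} (hab : G.Adj a b) (hac : G.Adj a c)
    (hbc : G.Adj b c) :
    ∃ e : SimpleGraph.completeGraph (Fin 3) ↪g G, Set.range e = {a, b, c} := by
  have := hab.ne
  have := hac.ne
  have := hbc.ne
  obtain ⟨e, he⟩ := exists_embedding (G := G) (H := SimpleGraph.completeGraph (Fin 3)) ![a, b, c]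
    (by intro i j; fin_cases i <;> fin_cases j <;> simp <;> grind)
    (by intro i j; fin_cases i <;> fin_cases j <;>
      simp [hab, hab.symm, hac, hac.symm, hbc, hbc.symm])
  exact ⟨e, he.trans (by ext v; simp [eq_comm]; tauto)⟩

/-! ### At least three colours, two of them repeated, with a triangle. -/

/-- If two colours are used twice, a triangle has no further neighbours. -/
theorem OneSwap.triangle_isolated (h : OneSwap G k) {f : V → Fin k} (hf : IsProper G f)
    {p p' q q' : V} (hp : p ≠ p') (hq : q ≠ q') (h1 : f p = f p') (h2 : f q = f q')
    (hpq : f p ≠ f q) {a b c d : V} (hab : G.Adj a b) (hac : G.Adj a c) (hbc : G.Adj b c)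
    (hdb : d ≠ b) (hdc : d ≠ c) : ¬ G.Adj a d := by
  intro had
  -- Each of the two possible matchings of non-edges between `ad` and `bc` contains `ab` or `ac`.
  have := h.cross_nonadj hf hp hq h1 h2 hpq (a := a) (a' := d) (b := b) (b' := c)
    (by simp [had.ne, hab.ne, hac.ne, hbc.ne, hdb, hdc]) had hbc
  simp [hab, hac] at this

/-- The triangle is a component. Once `k = 3`, it uses every colour, and no colour occurs three
times, so the other vertices have distinct colours. -/
theorem OneSwap.triangle_case [Finite V] (h : OneSwap G k) (hs : AllSurjective G k) (hk : 3 ≤ k)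
    {f : V → Fin k} (hf : IsProper G f) {p p' q q' : V} (hp : p ≠ p') (hq : q ≠ q')
    (h1 : f p = f p') (h2 : f q = f q') (hpq : f p ≠ f q) {a b c : V} (hab : G.Adj a b)
    (hac : G.Adj a c) (hbc : G.Adj b c) :
    Nonempty (G ≃g (SimpleGraph.completeGraph (Fin 3) ⊕g SimpleGraph.completeGraph (Fin 2))) ∨
    Nonempty (G ≃g (SimpleGraph.completeGraph (Fin 3) ⊕g SimpleGraph.completeGraph (Fin 3))) := by
  classical
  have three : ∀ g : V → Fin k, IsProper G g → ∀ x y z, [x, y, z].Nodup → g x = g y →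
      g x = g z → False := fun g hg x y z hn e1 e2 => h.no_triangle hg hn e1 e2 hab hac hbc
  have ha : ∀ d, d ≠ b → d ≠ c → ¬ G.Adj a d := fun d =>
    h.triangle_isolated hf hp hq h1 h2 hpq hab hac hbc
  have hb : ∀ d, d ≠ a → d ≠ c → ¬ G.Adj b d := fun d =>
    h.triangle_isolated hf hp hq h1 h2 hpq hab.symm hbc hac
  have hc : ∀ d, d ≠ a → d ≠ b → ¬ G.Adj c d := fun d =>
    h.triangle_isolated hf hp hq h1 h2 hpq hac.symm hbc.symm hab
  have fab := hf hab
  have fac := hf hac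
  have fbc := hf hbc
  have hk3 : k = 3 := by
    by_contra hk'
    -- With a fourth colour, the triangle can be recoloured without `j`. If no outside edge joined
    -- classes `i` and `j`, merging them outside would make `j` unused.
    have cross : ∀ i j : Fin k, i ≠ j → ∃ u v, G.Adj u v ∧ f u = i ∧ f v = j ∧
        (u ≠ a ∧ u ≠ b ∧ u ≠ c) ∧ (v ≠ a ∧ v ≠ b ∧ v ≠ c) := by
      intro i j hij
      obtain ⟨σ, hσ⟩ : ∃ g : Fin 3 → Fin k, g.Injective ∧ ∀ t, g t ≠ j := by
        have hcard : 3 ≤ Fintype.card {t : Fin k // t ≠ j} := by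
          simp; omega
        obtain ⟨g⟩ := Function.Embedding.nonempty_of_card_le (α := Fin 3) (β := {t : Fin k // t ≠ j})
          (by rw [Fintype.card_fin]; exact hcard)
        exact ⟨fun t => g t, fun s t hst => g.injective (Subtype.ext hst), fun t => (g t).2⟩
      have s01 : σ 0 ≠ σ 1 := fun h => by simpa using hσ.1 h
      have s02 : σ 0 ≠ σ 2 := fun h => by simpa using hσ.1 h
      have s12 : σ 1 ≠ σ 2 := fun h => by simpa using hσ.1 h
      by_contra! hno
      obtain ⟨w, hw⟩ := hs (fun w => if w = a then σ 0 else if w = b then σ 1 else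
        if w = c then σ 2 else if f w = j then i else f w) (by
        intro u v huv
        have := huv.ne
        have := hf huv
        have := huv.symm
        have := hno u v huv
        have := hno v u huv.symm
        by_cases hua : u = a
        · have := ha v; grind
        by_cases hub : u = b
        · have := hb v; grind
        by_cases huc : u = c
        · have := hc v; grind
        by_cases hva : v = a
        · have := ha u; grind
        by_cases hvb : v = b
        · have := hb u; grind
        by_cases hvc : v = c
        · have := hc u; grind
        grind) j
      have := hσ.2 0
      have := hσ.2 1
      have := hσ.2 2
      grind
    obtain ⟨u, v, huv, hu, hv, hun, hvn⟩ := cross (f a) (f b) fab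
    obtain ⟨w, -, -, hw, -, hwn, -⟩ := cross (f c) (f b) fbc.symm
    obtain ⟨l, hl⟩ : ∃ l : Fin k, l ∉ ({f a, f b, f c} : Finset (Fin k)) := by
      by_contra! hall
      have h5 := Finset.card_le_card (s := Finset.univ) (t := {f a, f b, f c}) fun x _ => hall x
      have h6 := Finset.card_le_three (a := f a) (b := f b) (c := f c)
      rw [Finset.card_univ, Fintype.card_fin] at h5
      omega
    simp at hl
    obtain ⟨x, y, hxy, hx, hy, hxn, hyn⟩ := cross (f c) l (by grind)
    have := huv.ne
    have := hxy.ne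
    -- The colours of `a`, `b`, `c` recur at `u`, `v`, `w`. The edges `uv` and `xy` are disjoint
    -- because their ends have four different colours.
    exact h.no_three_matching hf (p := a) (p' := u) (q := b) (q' := v) (r := c) (r' := w)
      (by grind) (by grind) (by grind) hu.symm hv.symm hw.symm fab fac fbc
      (a := a) (a' := b) (b := u) (b' := v) (c := x) (c' := y)
      (by have := hab.ne; simp; grind) hab huv hxy
  subst hk3
  have hcol : ∀ i, i = f a ∨ i = f b ∨ i = f c := by omega
  obtain ⟨eT, heT⟩ := exists_embedding_complete_three hab hac hbc
  have hab' := hab.ne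
  have hac' := hac.ne
  have hbc' := hbc.ne
  have hinj : ∀ u v, u ≠ a → u ≠ b → u ≠ c → v ≠ a → v ≠ b → v ≠ c → f u = f v → u = v := by
    intro u v _ _ _ _ _ _ huv
    by_contra hne
    rcases hcol (f u) with hu | hu | hu
    · exact three f hf a u v (by simp; grind) hu.symm (by rw [← huv, hu])
    · exact three f hf b u v (by simp; grind) hu.symm (by rw [← huv, hu])
    · exact three f hf c u v (by simp; grind) hu.symm (by rw [← huv, hu])
  have hclique : ∀ u v, u ≠ a → u ≠ b → u ≠ c → v ≠ a → v ≠ b → v ≠ c → u ≠ v → G.Adj u v := by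
    intro u v hua hub huc hva hvb hvc huv
    by_contra hnadj
    -- Giving `v` the colour of its non-neighbour `u` is proper, since outside the triangle only `u`
    -- has that colour. The colour then occurs three times.
    have hg : IsProper G (fun w => if w = v then f u else f w) := by
      have key : ∀ w, G.Adj v w → f u ≠ f w := by
        intro w hw he
        have h1 := ha v hvb hvc
        have h2 := hb v hva hvc
        have h3 := hc v hva hvb
        have hwa : w ≠ a := by rintro rfl; exact h1 hw.symm
        have hwb : w ≠ b := by rintro rfl; exact h2 hw.symm
        have hwc : w ≠ c := by rintro rfl; exact h3 hw.symm
        have := hinj u w hua hub huc hwa hwb hwc he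
        exact hnadj (this ▸ hw.symm)
      intro x y hxy
      have := key x
      have := key y
      have := hf hxy
      have := hxy.ne
      have := hxy.symm
      grind
    rcases hcol (f u) with hu | hu | hu
    · exact three _ hg a u v (by simp; grind) (by simp; grind) (by simp; grind)
    · exact three _ hg b u v (by simp; grind) (by simp; grind) (by simp; grind)
    · exact three _ hg c u v (by simp; grind) (by simp; grind) (by simp; grind)
  have big : ∀ p p', p ≠ p' → f p = f p' → ∃ u, u ≠ a ∧ u ≠ b ∧ u ≠ c ∧ f u = f p := by
    intro p p' hp h1
    by_cases hpp : p ≠ a ∧ p ≠ b ∧ p ≠ c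
    · exact ⟨p, hpp.1, hpp.2.1, hpp.2.2, rfl⟩
    · exact ⟨p', by grind, by grind, by grind, h1.symm⟩
  obtain ⟨u, hua, hub, huc, hu⟩ := big p p' hp h1
  obtain ⟨v, hva, hvb, hvc, hv⟩ := big q q' hq h2
  have huv : u ≠ v := by grind
  by_cases hw : ∃ w, w ≠ a ∧ w ≠ b ∧ w ≠ c ∧ w ≠ u ∧ w ≠ v
  · right
    obtain ⟨w, hwa, hwb, hwc, hwu, hwv⟩ := hw
    obtain ⟨e, he⟩ := exists_embedding_complete_three (hclique u v hua hub huc hva hvb hvc huv)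
      (hclique u w hua hub huc hwa hwb hwc hwu.symm) (hclique v w hva hvb hvc hwa hwb hwc hwv.symm)
    refine nonempty_iso_sum eT e ?_ ?_ ?_
    · simp only [heT, he]; rintro x (rfl | rfl | rfl) y (rfl | rfl | rfl) <;> grind
    · simp only [heT, he]; rintro x (rfl | rfl | rfl) y (rfl | rfl | rfl) <;> grind
    · intro x
      simp only [heT, he]
      by_contra! hx
      simp at hx
      have h1 := hinj x u
      have h2 := hinj x v
      have h3 := hinj x w
      have h4 := hinj u v
      have h5 := hinj u w
      have h6 := hinj v w
      have : f x ≠ f u := by grind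
      have : f x ≠ f v := by grind
      have : f x ≠ f w := by grind
      have : f u ≠ f v := by grind
      have : f u ≠ f w := by grind
      have : f v ≠ f w := by grind
      omega
  · left
    obtain ⟨e, he⟩ := exists_embedding_complete_two (hclique u v hua hub huc hva hvb hvc huv)
    refine nonempty_iso_sum eT e ?_ ?_ ?_
    · simp only [heT, he]; rintro x (rfl | rfl | rfl) y (rfl | rfl) <;> grind
    · simp only [heT, he]; rintro x (rfl | rfl | rfl) y (rfl | rfl) <;> grind
    · intro x
      simp only [heT, he]
      by_contra! hx
      simp only [Set.mem_insert_iff, Set.mem_singleton_iff, not_or] at hx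
      exact hw ⟨x, hx.1.1, hx.1.2.1, hx.1.2.2, hx.2.1, hx.2.2⟩

theorem OneSwap.noThreeMatching (h : OneSwap G k) {f : V → Fin k} (hf : IsProper G f)
    {p p' q q' r r' : V} (hp : p ≠ p') (hq : q ≠ q') (hr : r ≠ r') (h1 : f p = f p')
    (h2 : f q = f q') (h3 : f r = f r') (hpq : f p ≠ f q) (hpr : f p ≠ f r) (hqr : f q ≠ f r) :
    NoThreeMatching G := fun _ _ _ _ _ _ hm ha hb hc =>
  h.no_three_matching hf hp hq hr h1 h2 h3 hpq hpr hqr hm ha hb hc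

/-! ### At least three colours, two of them repeated, without triangles. -/

/-- If there are no triangles, no three colours are used twice. -/
theorem OneSwap.three_big_elim (h : OneSwap G k) (hs : AllSurjective G k) (hk : 3 ≤ k)
    (hT : NoTriangle G) {f : V → Fin k} (hf : IsProper G f)
    {p p' q q' r r' : V} (hp : p ≠ p') (hq : q ≠ q') (hr : r ≠ r') (h1 : f p = f p')
    (h2 : f q = f q') (h3 : f r = f r') (hpq : f p ≠ f q) (hpr : f p ≠ f r) (hqr : f q ≠ f r) :
    False := by
  classical
  have hM := h.noThreeMatching hf hp hq hr h1 h2 h3 hpq hpr hqr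
  obtain ⟨a, b, c, d, e, hn, hab, hbc, hcd, hde, hea⟩ := exists_five_cycle hT hM
    (fun S hS => hs.not_bipartite hk S hS)
  obtain ⟨z, hz⟩ : ∃ z, z ∉ ({a, b, c, d, e} : Finset V) := by
    by_contra! hall
    have h5 := Finset.card_le_card (s := {p, p', q, q', r, r'}) (t := {a, b, c, d, e})
      fun x _ => hall x
    have h6 : ({a, b, c, d, e} : Finset V).card ≤ 5 := Finset.card_le_five
    have h7 : ([p, p', q, q', r, r'].toFinset).card = 6 :=
      List.toFinset_card_of_nodup (by simp; grind (splits := 40))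
    simp only [List.toFinset_cons, List.toFinset_nil, insert_empty_eq] at h7
    omega
  simp only [Finset.mem_insert, Finset.mem_singleton, not_or] at hz
  have hn' := hn
  simp only [List.nodup_cons, List.mem_cons, List.not_mem_nil, not_or, or_false,
    not_false_eq_true, List.nodup_nil, and_true] at hn
  -- A 5-cycle minus any one vertex has two disjoint edges, so an edge at `z` would complete three.
  have hiso : ∀ w, ¬ G.Adj z w := by
    intro w hzw
    have := hzw.ne
    by_cases ha : w = a
    · exact hM (by simp; grind) hzw hbc hde
    by_cases hb : w = b
    · exact hM (by simp; grind) hzw hcd hea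
    by_cases hc : w = c
    · exact hM (by simp; grind) hzw hde hab
    by_cases hd : w = d
    · exact hM (by simp; grind) hzw hea hbc
    by_cases he : w = e
    · exact hM (by simp; grind) hzw hab hcd
    · exact hM (by simp; grind) hzw hab hcd
  -- The isolated vertex `z` may take a repeated colour. This yields one colour used three times and
  -- another used twice, contrary to `no_five_cycle`.
  have fin : ∀ {p p' q q' : V}, p ≠ p' → q ≠ q' → f p = f p' → f q = f q' → f p ≠ f q →
      f z ≠ f p → f z ≠ f q → False := by
    intro p p' q q' hp hq h1 h2 hpq hzp hzq
    refine h.no_five_cycle (f := fun w => if w = z then f p else f w) ?_ (p := p) (q := p')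
      (r := z) (s := q) (t := q') (by simp; grind) hq (by grind) (by grind) (by grind) (by grind)
      hn' hab hbc hcd hde hea
    intro u v huv
    have := hf huv
    have : u ≠ z := by rintro rfl; exact hiso _ huv
    have : v ≠ z := by rintro rfl; exact hiso _ huv.symm
    grind
  by_cases hzp : f z = f p
  · exact fin hq hr h2 h3 hqr (by grind) (by grind)
  by_cases hzq : f z = f q
  · exact fin hp hr h1 h3 hpr (by grind) (by grind)
  · exact fin hp hq h1 h2 hpq hzp hzq

theorem nonempty_iso_cycleGraph_five {a b c d e : V} (hn : [a, b, c, d, e].Nodup)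
    (hab : G.Adj a b) (hbc : G.Adj b c) (hcd : G.Adj c d) (hde : G.Adj d e) (hea : G.Adj e a)
    (hac : ¬ G.Adj a c) (hbd : ¬ G.Adj b d) (hce : ¬ G.Adj c e) (hda : ¬ G.Adj d a)
    (heb : ¬ G.Adj e b) (hcov : ∀ v, v = a ∨ v = b ∨ v = c ∨ v = d ∨ v = e) :
    Nonempty (G ≃g SimpleGraph.cycleGraph 5) := by
  simp at hn
  obtain ⟨g, hg⟩ := exists_embedding (G := G) (H := SimpleGraph.cycleGraph 5) ![a, b, c, d, e]
    (by intro i j; fin_cases i <;> fin_cases j <;> simp <;> grind)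
    (by intro i j; fin_cases i <;> fin_cases j <;>
      first
      | exact iff_of_true (by assumption) (by decide)
      | exact iff_of_true (G.adj_symm (by assumption)) (by decide)
      | exact iff_of_false (by assumption) (by decide)
      | exact iff_of_false (fun h => absurd (G.adj_symm h) (by assumption)) (by decide)
      | exact iff_of_false (G.irrefl) (by decide))
  refine nonempty_iso_of_surjective g fun v => ?_
  rw [hg]
  have := hcov v
  simp
  grind

/-- Moving a vertex to a class that contains none of its neighbours. -/
theorem IsProper.update [DecidableEq V] {f : V → Fin k} (hf : IsProper G f) {a : V} {i : Fin k}
    (hi : ∀ w, G.Adj a w → f w ≠ i) : IsProper G (fun w => if w = a then i else f w) := by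
  intro u v huv
  have := hf huv
  have := huv.ne
  have := hi u
  have := hi v
  have := huv.symm
  grind

theorem OneSwap.triangle_free_case (h : OneSwap G k) (hs : AllSurjective G k) (hk : 3 ≤ k)
    (hT : NoTriangle G) {f : V → Fin k} (hf : IsProper G f) {p p' q q' : V} (hp : p ≠ p')
    (hq : q ≠ q') (h1 : f p = f p') (h2 : f q = f q') (hpq : f p ≠ f q) :
    Nonempty (G ≃g SimpleGraph.cycleGraph 5) := by
  classical
  have single : ∀ u, f u ≠ f p → f u ≠ f q → ∀ w, f w = f u → w = u := by
    intro u hup huq w hw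
    by_contra hwu
    exact h.three_big_elim hs hk hT hf hp hq hwu h1 h2 hw hpq (by grind) (by grind)
  obtain ⟨l, hlp, hlq⟩ := exists_third hk (f p) (f q)
  obtain ⟨u, rfl⟩ := hs f hf l
  have hu := single u hlp hlq
  have hcol : ∀ w, f w = f p ∨ f w = f q ∨ w = u := by
    intro w
    by_contra! hw
    exact hs.not_two_singletons hT hk hf hw.2.2 (single w hw.1 hw.2.1) hu
  -- A third vertex in the class is impossible: moving the non-neighbour `a` of `u` to the class of
  -- `u` would leave three repeated colours.
  have cls : ∀ {p p' q q' : V}, p ≠ p' → q ≠ q' → f p = f p' → f q = f q' → f p ≠ f q →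
      f u ≠ f p → f u ≠ f q → ∃ a a', a ≠ a' ∧ f a = f p ∧ f a' = f p ∧ ¬ G.Adj u a ∧
      ∀ w, f w = f p → w = a ∨ w = a' := by
    intro p p' q q' hp hq h1 h2 hpq hup huq
    obtain ⟨a, ha, hua⟩ := hs.exists_not_adj hT hk hf hu hup.symm
    obtain ⟨a', ha', haa⟩ : ∃ a', f a' = f p ∧ a ≠ a' := by
      by_cases h : a = p
      · exact ⟨p', h1.symm, by grind⟩
      · exact ⟨p, rfl, h⟩
    refine ⟨a, a', haa, ha, ha', hua, fun w hw => ?_⟩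
    by_contra! hwa
    have hg := hf.update (a := a) (i := f u) (by
      intro w hw he
      rw [hu w he] at hw
      exact hua hw.symm)
    exact h.three_big_elim hs hk hT hg (p := a') (p' := w) (q := q) (q' := q') (r := a) (r' := u)
      hwa.2.symm hq (by grind) (by grind) (by grind) (by grind) (by grind) (by grind) (by grind)
  obtain ⟨a, a', haa, ha, ha', hua, hA⟩ := cls hp hq h1 h2 hpq hlp hlq
  obtain ⟨b, b', hbb, hb, hb', hub, hB⟩ := cls hq hp h2 h1 hpq.symm hlq hlp
  have hcov : ∀ w, w = u ∨ w = a' ∨ w = b ∨ w = a ∨ w = b' := by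
    intro w
    have := hcol w
    have := hA w
    have := hB w
    grind
  have naa : ¬ G.Adj a a' := fun h => hf h (by grind)
  have nbb : ¬ G.Adj b b' := fun h => hf h (by grind)
  -- Each missing edge of the cycle `u a' b a b'` would leave an explicit bipartition.
  have bip : ∀ S : V → Prop, (∀ x y, (S x ↔ S y) → G.Adj x y → False) → False := by
    intro S hS
    refine hs.not_bipartite hk S fun x y hxy => ?_
    have := hS x y
    tauto
  have hn : [u, a', b, a, b'].Nodup := by simp; grind
  have hn' := hn
  simp at hn'
  have ua' : G.Adj u a' := by
    by_contra hno
    refine bip (fun w => w = u ∨ w = a ∨ w = a') fun x y hxy hadj => ?_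
    have := hadj.ne
    have := hadj.symm
    rcases hcov x with rfl | rfl | rfl | rfl | rfl <;>
      rcases hcov y with rfl | rfl | rfl | rfl | rfl <;> grind
  have ub' : G.Adj u b' := by
    by_contra hno
    refine bip (fun w => w = u ∨ w = b ∨ w = b') fun x y hxy hadj => ?_
    have := hadj.ne
    have := hadj.symm
    rcases hcov x with rfl | rfl | rfl | rfl | rfl <;>
      rcases hcov y with rfl | rfl | rfl | rfl | rfl <;> grind
  have nab' : ¬ G.Adj a' b' := fun h => hT ua' ub' h
  have ab : G.Adj b a := by
    by_contra hno
    refine bip (fun w => w = u ∨ w = b ∨ w = a) fun x y hxy hadj => ?_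
    have := hadj.ne
    have := hadj.symm
    rcases hcov x with rfl | rfl | rfl | rfl | rfl <;>
      rcases hcov y with rfl | rfl | rfl | rfl | rfl <;> grind
  have ab' : G.Adj a b' := by
    by_contra hno
    refine bip (fun w => w = u ∨ w = b) fun x y hxy hadj => ?_
    have := hadj.ne
    have := hadj.symm
    rcases hcov x with rfl | rfl | rfl | rfl | rfl <;>
      rcases hcov y with rfl | rfl | rfl | rfl | rfl <;> grind
  have a'b : G.Adj a' b := by
    by_contra hno
    refine bip (fun w => w = u ∨ w = a) fun x y hxy hadj => ?_
    have := hadj.ne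
    have := hadj.symm
    rcases hcov x with rfl | rfl | rfl | rfl | rfl <;>
      rcases hcov y with rfl | rfl | rfl | rfl | rfl <;> grind
  exact nonempty_iso_cycleGraph_five hn ua' a'b ab ab' ub'.symm hub
    (fun h => naa h.symm) nbb (fun h => hua h.symm) (fun h => nab' h.symm) hcov

/-! ### At least three colours, never two of them repeated. -/

/-- If no optimal colouring has two classes with more than one vertex, the graph is complete up to
a vertex of degree at most one. -/
theorem OneSwap.almost_complete (h : OneSwap G k) (hs : AllSurjective G k) (hk : 3 ≤ k)
    (hone : ∀ g : V → Fin k, IsProper G g → ∀ p p' q q', p ≠ p' → q ≠ q' → g p = g p' →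
      g q = g q' → g p = g q)
    {f : V → Fin k} (hf : IsProper G f) {p p' : V} (hp : p ≠ p') (h1 : f p = f p') :
    ∃ v, (∀ a b, a ≠ v → b ≠ v → a ≠ b → G.Adj a b) ∧
      ∀ a b, G.Adj v a → G.Adj v b → a = b := by
  classical
  have single : ∀ u w, f u ≠ f p → f w = f u → w = u := by
    intro u w hu hw
    by_contra hwu
    exact hu ((hone f hf p p' w u hp hwu h1 hw).trans hw).symm
  have sadj : ∀ u v, f u ≠ f p → f v ≠ f p → u ≠ v → G.Adj u v := by
    intro u v hu hv huv
    obtain ⟨x, y, hxy, hx, hy⟩ := hs.exists_adj hf (i := f u) (j := f v)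
      (fun he => huv (single v u hv he))
    rwa [single u x hu hx, single v y hv hy] at hxy
  have hcls : ∀ w, f w = f p → w = p ∨ w = p' := by
    intro w hw
    by_contra! hwp
    -- Otherwise `p` could join the singleton class of `u`, and two colours would be repeated. So
    -- `p` forms a triangle with two singletons, against a colour used three times.
    have hadj : ∀ u, f u ≠ f p → G.Adj p u := by
      intro u hu
      by_contra hpu
      have hg := hf.update (a := p) (i := f u) (by
        intro z hz he
        exact hpu (single u z hu he ▸ hz))
      have := hone _ hg p u p' w (by grind) (by grind) (by grind) (by grind)
      grind
    obtain ⟨i, hi, -⟩ := exists_third hk (f p) (f p)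
    obtain ⟨u, rfl⟩ := hs f hf i
    obtain ⟨j, hj, hj'⟩ := exists_third hk (f p) (f u)
    obtain ⟨v, rfl⟩ := hs f hf j
    exact h.no_triangle hf (p := p) (q := p') (r := w) (by simp; grind) h1 hw.symm (hadj u hi)
      (hadj v hj) (sadj u v hi hj (by grind))
  have huniv : (∀ w, w ≠ p → w ≠ p' → G.Adj p w) ∨ (∀ w, w ≠ p → w ≠ p' → G.Adj p' w) := by
    by_contra! hc
    obtain ⟨⟨w, hwp, hwp', hw⟩, w', hwp2, hwp2', hw'⟩ := hc
    have fw : f w ≠ f p := fun he => by have := hcls w he; grind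
    have fw' : f w' ≠ f p := fun he => by have := hcls w' he; grind
    have hww : w ≠ w' := by
      rintro rfl
      obtain ⟨x, y, hxy, hx, hy⟩ := hs.exists_adj hf fw
      rw [single w x fw hx] at hxy
      rcases hcls y hy with rfl | rfl
      · exact hw hxy.symm
      · exact hw' hxy.symm
    -- Pairing `p'` with `w'` and `w` with `p` would repeat two colours.
    have hg := hf.update (a := p') (i := f w') (by
      intro z hz he
      exact hw' (single w' z fw' he ▸ hz))
    have hg' := hg.update (a := w) (i := f p) (by
      intro z hz he
      have := hcls z
      have := hz.symm
      have := hz.ne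
      grind)
    have := hone _ hg' p w p' w' (by grind) (by grind) (by grind) (by grind)
    grind
  obtain ⟨v, c, hvc, fv, fc, hc, hcv⟩ : ∃ v c, v ≠ c ∧ f v = f p ∧ f c = f p ∧
      (∀ w, w ≠ v → w ≠ c → G.Adj c w) ∧ ∀ w, f w = f p → w = v ∨ w = c := by
    rcases huniv with hh | hh
    · exact ⟨p', p, hp.symm, h1.symm, rfl, by grind, by grind⟩
    · exact ⟨p, p', hp, rfl, h1.symm, by grind, by grind⟩
  have hcomp : ∀ a b, a ≠ v → b ≠ v → a ≠ b → G.Adj a b := by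
    intro a b ha hb hab
    by_cases hac : a = c
    · subst hac; exact hc b hb hab.symm
    by_cases hbc : b = c
    · subst hbc; exact (hc a ha hab).symm
    exact sadj a b (fun he => by have := hcv a he; grind) (fun he => by have := hcv b he; grind) hab
  refine ⟨v, hcomp, fun a b ha hb => ?_⟩
  by_contra hab
  -- Two neighbours `a`, `b` of `v` receive the repeated colour. After an exchange it remains on `a`
  -- or `b` and is still used twice; the clique `G - v` forces it onto `v`, next to the one that
  -- kept it.
  obtain ⟨C, D, x, y, hC, hx, hy, hw, hD⟩ := h.exists_swap hf [(a, p), (b, p')] (by simpa using hab)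
    (by simpa using hp)
  simp at hC
  have coll : ∀ x y, D x = D y → x = y ∨ x = v ∨ y = v := by
    intro x y he
    by_contra! hc
    exact hD (hcomp x y hc.2.1 hc.2.2 hc.1) he
  have hva := hD ha
  have hvb := hD hb
  have key : ∀ z, D z = C a → z = v := by
    intro z hz
    have := coll z a
    have := coll z b
    have := hw a
    have := hw b
    have := ha.ne
    have := hb.ne
    have := coll a b
    have := coll x a
    have := coll x b
    have := coll y a
    have := coll y b
    by_cases z = a <;> by_cases z = b <;> grind
  have := key a
  have := key b
  have := key x
  have := key y
  have := hw a
  have := hw b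
  have := ha.ne
  have := hb.ne
  have := coll a b
  grind

/-! ### Embeddings of small bipartite graphs. -/

theorem exists_embedding_emptyGraph [Finite V] (S : Set V)
    (hS : ∀ x ∈ S, ∀ y ∈ S, ¬ G.Adj x y) :
    ∃ e : SimpleGraph.emptyGraph (Fin S.ncard) ↪g G, Set.range e = S := by
  have e := (Finite.equivFin S).symm
  obtain ⟨e', he'⟩ := exists_embedding (G := G) (H := SimpleGraph.emptyGraph (Fin (Nat.card S)))
    (fun i => (e i : V)) (fun i j hij => e.injective (Subtype.ext hij))
    (fun i j => iff_of_false (hS _ (e i).2 _ (e j).2) id)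
  refine ⟨e', he'.trans ?_⟩
  ext v
  constructor
  · rintro ⟨i, rfl⟩; exact (e i).2
  · intro hv; exact ⟨e.symm ⟨v, hv⟩, congrArg Subtype.val (e.apply_symm_apply _)⟩

theorem exists_embedding_path_three {a b c : V} (hac' : a ≠ c) (hab : G.Adj a b) (hbc : G.Adj b c)
    (hac : ¬ G.Adj a c) : ∃ e : SimpleGraph.pathGraph 3 ↪g G, Set.range e = {a, b, c} := by
  have := hab.ne
  have := hbc.ne
  obtain ⟨e, he⟩ := exists_embedding (G := G) (H := SimpleGraph.pathGraph 3) ![a, b, c]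
    (by intro i j; fin_cases i <;> fin_cases j <;> simp <;> grind)
    (by intro i j; fin_cases i <;> fin_cases j <;>
          simp [SimpleGraph.pathGraph_adj, hab, hab.symm, hac, hbc, hbc.symm, G.adj_comm c a])
  exact ⟨e, he.trans (by ext v; simp [eq_comm]; tauto)⟩

theorem exists_embedding_path_four {a b c d : V} (hn : [a, b, c, d].Nodup) (hab : G.Adj a b)
    (hbc : G.Adj b c) (hcd : G.Adj c d) (hac : ¬ G.Adj a c) (hbd : ¬ G.Adj b d)
    (had : ¬ G.Adj a d) :
    ∃ e : SimpleGraph.pathGraph 4 ↪g G, Set.range e = {a, b, c, d} := by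
  simp at hn
  obtain ⟨e, he⟩ := exists_embedding (G := G) (H := SimpleGraph.pathGraph 4) ![a, b, c, d]
    (by intro i j; fin_cases i <;> fin_cases j <;> simp <;> grind)
    (by intro i j; fin_cases i <;> fin_cases j <;>
          simp [SimpleGraph.pathGraph_adj, hab, hab.symm, hbc, hbc.symm, hcd, hcd.symm, hac, hbd,
            had, G.adj_comm c a, G.adj_comm d b, G.adj_comm d a])
  exact ⟨e, he.trans (by ext v; simp [eq_comm]; tauto)⟩

theorem exists_embedding_cycle_four {a b c d : V} (hn : [a, b, c, d].Nodup) (hab : G.Adj a b)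
    (hbc : G.Adj b c) (hcd : G.Adj c d) (had : G.Adj a d) (hac : ¬ G.Adj a c)
    (hbd : ¬ G.Adj b d) :
    ∃ e : SimpleGraph.cycleGraph 4 ↪g G, Set.range e = {a, b, c, d} := by
  simp at hn
  obtain ⟨e, he⟩ := exists_embedding (G := G) (H := SimpleGraph.cycleGraph 4) ![a, b, c, d]
    (by intro i j; fin_cases i <;> fin_cases j <;> simp <;> grind)
    (by intro i j; fin_cases i <;> fin_cases j <;>
      first
      | exact iff_of_true (by assumption) (by decide)
      | exact iff_of_true (G.adj_symm (by assumption)) (by decide)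
      | exact iff_of_false (by assumption) (by decide)
      | exact iff_of_false (fun h => absurd (G.adj_symm h) (by assumption)) (by decide)
      | exact iff_of_false (G.irrefl) (by decide))
  exact ⟨e, he.trans (by ext v; simp [eq_comm]; tauto)⟩

theorem exists_embedding_two_edges {a b c d : V} (hn : [a, b, c, d].Nodup) (hab : G.Adj a b)
    (hcd : G.Adj c d) (hac : ¬ G.Adj a c) (hbc : ¬ G.Adj b c) (had : ¬ G.Adj a d)
    (hbd : ¬ G.Adj b d) :
    ∃ e : (SimpleGraph.completeGraph (Fin 2) ⊕g SimpleGraph.completeGraph (Fin 2)) ↪g G,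
      Set.range e = {a, b, c, d} := by
  simp at hn
  obtain ⟨e, he⟩ := exists_embedding (G := G)
    (H := SimpleGraph.completeGraph (Fin 2) ⊕g SimpleGraph.completeGraph (Fin 2))
    (Sum.elim ![a, b] ![c, d])
    (by rintro (i | i) (j | j) <;> fin_cases i <;> fin_cases j <;> simp <;> grind)
    (by rintro (i | i) (j | j) <;> fin_cases i <;> fin_cases j <;>
          simp [hab, hab.symm, hcd, hcd.symm, hac, hbd, hbc,
            had, G.adj_comm c a, G.adj_comm d b, G.adj_comm d a, G.adj_comm c b])
  exact ⟨e, he.trans (by ext v; simp [eq_comm]; tauto)⟩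

/-- A bipartite graph with two vertices on each side and no isolated vertex is a path, a cycle or
a perfect matching. -/
theorem exists_embedding_two_by_two {a a' b b' : V} (hn : [a, a', b, b'].Nodup)
    (haa : ¬ G.Adj a a') (hbb : ¬ G.Adj b b') (ha : G.Adj a b ∨ G.Adj a b')
    (ha' : G.Adj a' b ∨ G.Adj a' b') (hb : G.Adj a b ∨ G.Adj a' b)
    (hb' : G.Adj a b' ∨ G.Adj a' b') :
    (∃ e : SimpleGraph.pathGraph 4 ↪g G, Set.range e = {a, a', b, b'}) ∨
    (∃ e : SimpleGraph.cycleGraph 4 ↪g G, Set.range e = {a, a', b, b'}) ∨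
    (∃ e : (SimpleGraph.completeGraph (Fin 2) ⊕g SimpleGraph.completeGraph (Fin 2)) ↪g G,
      Set.range e = {a, a', b, b'}) := by
  have hn' := hn
  simp at hn'
  have h1 : ∀ x y z w : V, ({x, y, z, w} : Set V) = {a, a', b, b'} → [x, y, z, w].Nodup := by
    classical
    intro x y z w hp
    have hf : [x, y, z, w].toFinset = [a, a', b, b'].toFinset := by
      apply Finset.coe_injective
      simpa using hp
    have := List.toFinset_card_of_nodup hn
    rw [← hf] at this
    exact Multiset.coe_nodup.1 (Multiset.toFinset_card_eq_card_iff_nodup.1 this)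
  have path : ∀ x y z w : V, ({x, y, z, w} : Set V) = {a, a', b, b'} → G.Adj x y → G.Adj y z →
      G.Adj z w → ¬ G.Adj x z → ¬ G.Adj y w → ¬ G.Adj x w →
      ∃ e : SimpleGraph.pathGraph 4 ↪g G, Set.range e = {a, a', b, b'} := by
    intro x y z w hp e1 e2 e3 e4 e5 e6
    exact hp ▸ exists_embedding_path_four (h1 x y z w hp) e1 e2 e3 e4 e5 e6
  have haa' := fun h => haa (G.adj_symm h)
  have hbb' := fun h => hbb (G.adj_symm h)
  by_cases e1 : G.Adj a b <;> by_cases e2 : G.Adj a b' <;> by_cases e3 : G.Adj a' b <;>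
    by_cases e4 : G.Adj a' b'
  · have hs : ({a, b, a', b'} : Set V) = {a, a', b, b'} := by ext; simp; clear * -; tauto
    exact .inr (.inl (hs ▸ exists_embedding_cycle_four (h1 _ _ _ _ hs) e1 e3.symm e4 e2 haa hbb))
  · exact .inl (path b' a b a' (by ext; simp; clear * -; tauto) e2.symm e1 e3.symm hbb' haa
      (fun h => e4 h.symm))
  · exact .inl (path b a b' a' (by ext; simp; clear * -; tauto) e1.symm e2 e4.symm hbb haa
      (fun h => e3 h.symm))
  · tauto
  · exact .inl (path b' a' b a (by ext; simp; clear * -; tauto) e4.symm e3 e1.symm hbb' haa'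
      (fun h => e2 h.symm))
  · tauto
  · have hs : ({a, b, a', b'} : Set V) = {a, a', b, b'} := by ext; simp; clear * -; tauto
    exact .inr (.inr (hs ▸ exists_embedding_two_edges (h1 _ _ _ _ hs) e1 e4 haa
      (fun h => e3 h.symm) e2 hbb))
  · tauto
  · exact .inl (path b a' b' a (by ext; simp; clear * -; tauto) e3.symm e4 e2.symm hbb haa'
      (fun h => e1 h.symm))
  · have hs : ({a, b', a', b} : Set V) = {a, a', b, b'} := by ext; simp; clear * -; tauto
    exact .inr (.inr (hs ▸ exists_embedding_two_edges (h1 _ _ _ _ hs) e2 e3 haa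
      (fun h => e4 h.symm) e1 hbb'))
  all_goals tauto

/-! ### Stars with isolated vertices. -/

theorem nonempty_iso_star [Finite V] {v : V} (hv : ∀ ⦃a b⦄, G.Adj a b → a = v ∨ b = v)
    (hall : ∀ w, w ≠ v → G.Adj v w) :
    Nonempty (G ≃g completeBipartiteGraph (Fin 1) (Fin ({w | w ≠ v} : Set V).ncard)) := by
  have hS : ∀ x ∈ {w | w ≠ v}, ∀ y ∈ {w | w ≠ v}, ¬ G.Adj x y := fun x hx y hy h =>
    (hv h).elim hx hy
  obtain ⟨e, he⟩ := exists_embedding_emptyGraph (G := G) {w | w ≠ v} hS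
  have hev : ∀ i, e i ≠ v := fun i => by
    have : e i ∈ Set.range e := ⟨i, rfl⟩
    rw [he] at this
    exact this
  obtain ⟨e', he'⟩ := exists_embedding (G := G)
    (H := completeBipartiteGraph (Fin 1) (Fin ({w | w ≠ v} : Set V).ncard))
    (Sum.elim (fun _ => v) e) (by
      rintro (i | i) (j | j) hij
      · simp [Subsingleton.elim i j]
      · exact (hev j hij.symm).elim
      · exact (hev i hij).elim
      · simpa using hij) (by
      rintro (i | i) (j | j)
      · simp
      · simpa using hall _ (hev j)
      · simpa using (hall _ (hev i)).symm
      · simpa using fun h => hv h |>.elim (hev i) (hev j))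
  refine nonempty_iso_of_surjective e' fun w => ?_
  rw [he']
  by_cases hw : w = v
  · exact ⟨.inl 0, hw.symm⟩
  · have : w ∈ Set.range e := by rw [he]; exact hw
    obtain ⟨i, rfl⟩ := this
    exact ⟨.inr i, rfl⟩

/-- A star with at least three leaves has no isolated vertex next to it. -/
theorem OneSwap.star_no_isolated (h : OneSwap G 2) {v : V}
    (hv : ∀ ⦃a b⦄, G.Adj a b → a = v ∨ b = v) {z : V} (hz : z ≠ v) (hvz : ¬ G.Adj v z)
    {l₁ l₂ l₃ : V} (hn : [l₁, l₂, l₃].Nodup) (h1 : G.Adj v l₁) (h2 : G.Adj v l₂)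
    (h3 : G.Adj v l₃) : False := by
  classical
  -- In the colouring with classes `{v, z}` and the rest, the colour of `v` and `z` is moved to two
  -- leaves. Then `v` disagrees with them but agrees with `l₃`, and no exchange makes it differ from
  -- all three.
  obtain ⟨σ, hσ⟩ := exists_perm_extending [(l₁, v), (l₂, z)] (by simp at hn ⊢; grind)
    (by simpa using hz.symm)
  simp at hσ hn
  obtain ⟨x, y, d, hx, hy, hd, hD⟩ := h (fun w => if w = v ∨ w = z then 0 else 1) (by
    intro a b hab
    have := hv hab
    have := hab.ne
    have := hab.symm
    grind) σ
  have hc : ∀ w, (σ w = v ∨ σ w = z) ↔ (w = l₁ ∨ w = l₂) := by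
    intro w
    have h4 := σ.injective.eq_iff (a := w) (b := l₁)
    have h5 := σ.injective.eq_iff (a := w) (b := l₂)
    rw [hσ.1] at h4
    rw [hσ.2] at h5
    rw [h4, h5]
  simp only [hc] at hx hy hd
  have := hD h1
  have := hD h2
  have := hD h3
  have := h1.ne
  have := h2.ne
  have := h3.ne
  have := hd v
  have := hd l₁
  have := hd l₂
  have := hd l₃
  grind

theorem OneSwap.star_case [Finite V] (h : OneSwap G 2) {v : V}
    (hv : ∀ ⦃a b⦄, G.Adj a b → a = v ∨ b = v) (hE : ∃ a b, G.Adj a b)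
    (hnc : ∃ a b, a ≠ b ∧ ¬ G.Adj a b) :
    (∃ t : ℕ, 2 ≤ t ∧ Nonempty (G ≃g completeBipartiteGraph (Fin 1) (Fin t))) ∨
    (∃ r : ℕ, 1 ≤ r ∧
      Nonempty (G ≃g (SimpleGraph.pathGraph 3 ⊕g SimpleGraph.emptyGraph (Fin r)))) ∨
    (∃ r : ℕ, 1 ≤ r ∧
      Nonempty (G ≃g (SimpleGraph.completeGraph (Fin 2) ⊕g SimpleGraph.emptyGraph (Fin r)))) := by
  by_cases hall : ∀ w, w ≠ v → G.Adj v w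
  · obtain ⟨a, b, hab, hnab⟩ := hnc
    refine .inl ⟨_, ?_, nonempty_iso_star hv hall⟩
    have : ({a, b} : Set V) ⊆ {w | w ≠ v} := by
      rintro w (rfl | rfl) rfl
      · exact hnab (hall b hab.symm)
      · exact hnab (hall a hab).symm
    simpa [Set.ncard_pair hab] using Set.ncard_le_ncard this
  push Not at hall
  obtain ⟨z, hz, hvz⟩ := hall
  obtain ⟨u, hu⟩ : ∃ u, G.Adj v u := by
    obtain ⟨a, b, hab⟩ := hE
    rcases hv hab with rfl | rfl
    · exact ⟨b, hab⟩
    · exact ⟨a, hab.symm⟩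
  right
  have rest : ∀ T : Set V, v ∈ T → (∀ w, G.Adj v w → w ∈ T) →
      (∀ w ∈ T, w = v ∨ G.Adj v w) → ∀ {W : Type} (H : SimpleGraph W) (e : H ↪g G),
      Set.range e = T →
      ∃ r : ℕ, 1 ≤ r ∧ Nonempty (G ≃g (H ⊕g SimpleGraph.emptyGraph (Fin r))) := by
    intro T hvT hT hT' W H e he
    obtain ⟨e', he'⟩ := exists_embedding_emptyGraph (G := G) Tᶜ (fun x hx y hy hxy => by
      rcases hv hxy with rfl | rfl
      · exact hx hvT
      · exact hy hvT)
    refine ⟨_, Nat.pos_of_ne_zero fun h0 => ?_, nonempty_iso_sum e e' ?_ ?_ ?_⟩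
    · rw [Set.ncard_eq_zero] at h0
      have hzT : z ∈ T := by_contra fun hzT => (h0 ▸ hzT : z ∈ (∅ : Set V))
      exact (hT' z hzT).elim hz hvz
    · rw [he, he']
      rintro x hx y hy rfl
      exact hy hx
    · rw [he, he']
      intro x hx y hy hxy
      rcases hv hxy with rfl | rfl
      · exact hy (hT _ hxy)
      · exact hy hvT
    · rw [he, he']
      exact fun w => em _
  by_cases hu' : ∃ u', u' ≠ u ∧ G.Adj v u'
  · obtain ⟨u', huu, hu'⟩ := hu'
    obtain ⟨e, he⟩ := exists_embedding_path_three huu.symm hu.symm hu' (fun hadj =>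
      (hv hadj).elim hu.ne' hu'.ne')
    refine .inl (rest {u, v, u'} (by simp) (fun w hw => ?_) ?_ _ e he)
    · by_contra hwT
      simp at hwT
      exact h.star_no_isolated hv hz hvz (l₁ := u) (l₂ := u') (l₃ := w) (by simp; grind) hu hu' hw
    · rintro w (rfl | rfl | rfl)
      · exact .inr hu
      · exact .inl rfl
      · exact .inr hu'
  · push Not at hu'
    obtain ⟨e, he⟩ := exists_embedding_complete_two hu
    refine .inr (rest {v, u} (by simp) (fun w hw => ?_) ?_ _ e he)
    · by_contra hwT
      simp at hwT
      exact hu' w hwT.2 hw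
    · rintro w (rfl | rfl)
      · exact .inl rfl
      · exact .inr hu

/-! ### Two colours, each used at most three times. -/

/-- No proper colouring uses a colour four times. -/
def NoFourfoldColour (G : SimpleGraph V) (k : ℕ) : Prop :=
  ∀ f : V → Fin k, IsProper G f → ∀ ⦃p q r s⦄, [p, q, r, s].Nodup → f p = f q → f p = f r →
    f p = f s → False

theorem NoFourfoldColour.not_bipartition (h4 : NoFourfoldColour G 2) (S : V → Prop)
    (hS : ∀ ⦃u v⦄, G.Adj u v → (S u ↔ ¬ S v)) {p q r s : V} (hn : [p, q, r, s].Nodup)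
    (hp : S p) (hq : S q) (hr : S r) (hs : S s) : False := by
  classical
  refine h4 (fun v => if S v then 0 else 1) (fun u v huv => ?_) hn (by simp [hp, hq])
    (by simp [hp, hr]) (by simp [hp, hs])
  have := hS huv
  grind

/-- The five-vertex graphs on bipartition classes of sizes three and two with an isolated vertex
in the larger class. -/
theorem NoFourfoldColour.three_two_isolated (h4 : NoFourfoldColour G 2)
    {a₁ a₂ a₃ b₁ b₂ : V} (hn : [a₁, a₂, a₃, b₁, b₂].Nodup)
    (hcov : ∀ v, v = a₁ ∨ v = a₂ ∨ v = a₃ ∨ v = b₁ ∨ v = b₂)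
    (h12 : ¬ G.Adj a₁ a₂) (h13 : ¬ G.Adj a₁ a₃) (h23 : ¬ G.Adj a₂ a₃) (hb : ¬ G.Adj b₁ b₂)
    (h31 : ¬ G.Adj a₃ b₁) (h32 : ¬ G.Adj a₃ b₂) :
    Nonempty (G ≃g (SimpleGraph.pathGraph 4 ⊕g SimpleGraph.completeGraph (Fin 1))) ∨
    Nonempty (G ≃g (SimpleGraph.cycleGraph 4 ⊕g SimpleGraph.completeGraph (Fin 1))) ∨
    Nonempty (G ≃g ((SimpleGraph.completeGraph (Fin 2) ⊕g SimpleGraph.completeGraph (Fin 2)) ⊕g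
        SimpleGraph.completeGraph (Fin 1))) := by
  have edge : ∀ u v, G.Adj u v → (G.Adj a₁ b₁ ∧ (u = a₁ ∧ v = b₁ ∨ u = b₁ ∧ v = a₁)) ∨
      (G.Adj a₁ b₂ ∧ (u = a₁ ∧ v = b₂ ∨ u = b₂ ∧ v = a₁)) ∨
      (G.Adj a₂ b₁ ∧ (u = a₂ ∧ v = b₁ ∨ u = b₁ ∧ v = a₂)) ∨
      (G.Adj a₂ b₂ ∧ (u = a₂ ∧ v = b₂ ∨ u = b₂ ∧ v = a₂)) := by
    intro u v huv
    have := huv.symm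
    have := huv.ne
    rcases hcov u with rfl | rfl | rfl | rfl | rfl <;>
      rcases hcov v with rfl | rfl | rfl | rfl | rfl <;> grind
  have hn' := hn
  simp at hn'
  have bip : ∀ S : V → Prop, (∀ u v, G.Adj u v → (S u ↔ ¬ S v)) → ∀ {p q r s : V},
      [p, q, r, s].Nodup → S p → S q → S r → S s → False :=
    fun S hS _ _ _ _ hn => h4.not_bipartition S hS hn
  -- A second isolated vertex beside `a₃` would allow a class of four vertices. Hence each of the
  -- other four has a neighbour.
  have hb1 : G.Adj a₁ b₁ ∨ G.Adj a₂ b₁ := by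
    by_contra! hc
    exact bip (fun w => w ≠ b₂) (fun u v huv => by have := edge u v huv; grind)
      (p := a₁) (q := a₂) (r := a₃) (s := b₁) (by simp; grind) (by grind) (by grind) (by grind)
      (by grind)
  have hb2 : G.Adj a₁ b₂ ∨ G.Adj a₂ b₂ := by
    by_contra! hc
    exact bip (fun w => w ≠ b₁) (fun u v huv => by have := edge u v huv; grind)
      (p := a₁) (q := a₂) (r := a₃) (s := b₂) (by simp; grind) (by grind) (by grind) (by grind)
      (by grind)
  have ha1 : G.Adj a₁ b₁ ∨ G.Adj a₁ b₂ := by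
    by_contra! hc
    exact bip (fun w => w ≠ a₂) (fun u v huv => by have := edge u v huv; grind)
      (p := a₁) (q := b₁) (r := a₃) (s := b₂) (by simp; grind) (by grind) (by grind) (by grind)
      (by grind)
  have ha2 : G.Adj a₂ b₁ ∨ G.Adj a₂ b₂ := by
    by_contra! hc
    exact bip (fun w => w ≠ a₁) (fun u v huv => by have := edge u v huv; grind)
      (p := a₂) (q := b₁) (r := a₃) (s := b₂) (by simp; grind) (by grind) (by grind) (by grind)
      (by grind)
  obtain ⟨e', he'⟩ := exists_embedding_complete_one (G := G) a₃
  have sum : ∀ {W : Type} {H : SimpleGraph W} (e : H ↪g G), Set.range e = {a₁, a₂, b₁, b₂} →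
      Nonempty (G ≃g (H ⊕g SimpleGraph.completeGraph (Fin 1))) := by
    intro W H e he
    refine nonempty_iso_sum e e' ?_ ?_ ?_
    · rw [he, he']; simp; grind
    · rw [he, he']; simp; grind [SimpleGraph.adj_comm]
    · rw [he, he']
      intro v
      have := hcov v
      simp
      clear * - this
      tauto
  rcases exists_embedding_two_by_two (G := G) (a := a₁) (a' := a₂) (b := b₁) (b' := b₂)
    (by simp; grind) h12 hb ha1 ha2 hb1 hb2 with ⟨e, he⟩ | ⟨e, he⟩ | ⟨e, he⟩
  · exact .inl (sum e he)
  · exact .inr (.inl (sum e he))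
  · exact .inr (.inr (sum e he))

/-- Recolouring two vertices of the larger class of a bipartition with sizes three and two by the
colour of the smaller class. -/
theorem OneSwap.exists_odd_vertex (h : OneSwap G 2) {x y z b₁ b₂ : V}
    (hn : [x, y, z, b₁, b₂].Nodup) (hcov : ∀ v, v = x ∨ v = y ∨ v = z ∨ v = b₁ ∨ v = b₂)
    (hxy : ¬ G.Adj x y) (hxz : ¬ G.Adj x z) (hyz : ¬ G.Adj y z) (hb : ¬ G.Adj b₁ b₂)
    (ix : G.Adj x b₁ ∨ G.Adj x b₂) (iy : G.Adj y b₁ ∨ G.Adj y b₂)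
    (iz : G.Adj z b₁ ∨ G.Adj z b₂) :
    ((G.Adj y b₂ ∧ ¬ G.Adj y b₁ ∧ G.Adj x b₁ ∧ ¬ G.Adj x b₂ ∧ G.Adj z b₁ ∧ ¬ G.Adj z b₂) ∨
    (G.Adj y b₁ ∧ ¬ G.Adj y b₂ ∧ G.Adj x b₂ ∧ ¬ G.Adj x b₁ ∧ G.Adj z b₂ ∧ ¬ G.Adj z b₁)) ∨
    ((G.Adj x b₂ ∧ ¬ G.Adj x b₁ ∧ G.Adj y b₁ ∧ ¬ G.Adj y b₂ ∧ G.Adj z b₁ ∧ ¬ G.Adj z b₂) ∨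
    (G.Adj x b₁ ∧ ¬ G.Adj x b₂ ∧ G.Adj y b₂ ∧ ¬ G.Adj y b₁ ∧ G.Adj z b₂ ∧ ¬ G.Adj z b₁)) := by
  classical
  have hn' := hn
  simp at hn'
  have hf : IsProper G (fun v => if v = b₁ ∨ v = b₂ then (1 : Fin 2) else 0) := by
    clear ix iy iz
    intro u v huv
    have huv' := huv.symm
    have := huv.ne
    rcases hcov u with rfl | rfl | rfl | rfl | rfl <;>
      rcases hcov v with rfl | rfl | rfl | rfl | rfl <;> first | contradiction | simp_all
  -- Now `z`, `b₁`, `b₂` have colour 0, and `z` has a neighbour there. Exchanging `x` or `y` with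
  -- `z` only moves the conflict, so it is exchanged with some `bᵢ`, which dictates all adjacencies.
  obtain ⟨C, D, s, t, hC, hs, ht, hw, hD⟩ := h.exists_swap hf
    [(x, b₁), (y, b₂), (z, x), (b₁, y), (b₂, z)] hn (by simp; grind)
  have hC' : C x = 1 ∧ C y = 1 ∧ C z = 0 ∧ C b₁ = 0 ∧ C b₂ = 0 := by simp at hC; grind
  have wx := hw x
  have wy := hw y
  have wz := hw z
  have w1 := hw b₁
  have w2 := hw b₂
  have x1 := @hD x b₁
  have x2 := @hD x b₂
  have y1 := @hD y b₁
  have y2 := @hD y b₂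
  have z1 := @hD z b₁
  have z2 := @hD z b₂
  have cs := hcov s
  have ct := hcov t
  have hval : ∀ i j : Fin 2, i ≠ j ↔ (i = 0 ↔ j = 1) := by decide
  obtain ⟨d1, d2, d3, d4, d5⟩ := hC'
  simp only [hval] at x1 x2 y1 y2 z1 z2
  clear hD hw h hf hC hcov hxy hxz hyz hb hn hval
  rcases cs with rfl | rfl | rfl | rfl | rfl <;> rcases ct with rfl | rfl | rfl | rfl | rfl <;>
    simp_all <;> grind (splits := 30)

/-- The five-vertex graphs on bipartition classes of sizes three and two. -/
theorem OneSwap.three_two_case (h : OneSwap G 2) (h4 : NoFourfoldColour G 2)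
    {a₁ a₂ a₃ b₁ b₂ : V} (hn : [a₁, a₂, a₃, b₁, b₂].Nodup)
    (hcov : ∀ v, v = a₁ ∨ v = a₂ ∨ v = a₃ ∨ v = b₁ ∨ v = b₂)
    (h12 : ¬ G.Adj a₁ a₂) (h13 : ¬ G.Adj a₁ a₃) (h23 : ¬ G.Adj a₂ a₃) (hb : ¬ G.Adj b₁ b₂) :
    Nonempty (G ≃g (SimpleGraph.pathGraph 4 ⊕g SimpleGraph.completeGraph (Fin 1))) ∨
    Nonempty (G ≃g (SimpleGraph.cycleGraph 4 ⊕g SimpleGraph.completeGraph (Fin 1))) ∨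
    Nonempty (G ≃g ((SimpleGraph.completeGraph (Fin 2) ⊕g SimpleGraph.completeGraph (Fin 2)) ⊕g
        SimpleGraph.completeGraph (Fin 1))) := by
  classical
  have hn' := hn
  simp at hn'
  by_cases i3 : G.Adj a₃ b₁ ∨ G.Adj a₃ b₂
  swap
  · push Not at i3
    exact h4.three_two_isolated hn hcov h12 h13 h23 hb i3.1 i3.2
  by_cases i2 : G.Adj a₂ b₁ ∨ G.Adj a₂ b₂
  swap
  · push Not at i2
    exact h4.three_two_isolated (a₁ := a₁) (a₂ := a₃) (a₃ := a₂) (by simp; grind)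
      (fun v => by have := hcov v; clear * - this; tauto) h13 h12
      (fun h => h23 h.symm) hb i2.1 i2.2
  by_cases i1 : G.Adj a₁ b₁ ∨ G.Adj a₁ b₂
  swap
  · push Not at i1
    exact h4.three_two_isolated (a₁ := a₂) (a₂ := a₃) (a₃ := a₁) (by simp; grind)
      (fun v => by have := hcov v; clear * - this; tauto) h23
      (fun h => h12 h.symm) (fun h => h13 h.symm) hb i1.1 i1.2
  exfalso
  -- One vertex is attached to a different `bᵢ` than the other two, and it would have to lie in each
  -- of the three pairs.
  have o12 := h.exists_odd_vertex hn hcov h12 h13 h23 hb i1 i2 i3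
  have o13 := h.exists_odd_vertex (x := a₁) (y := a₃) (z := a₂) (by simp; grind)
    (fun v => by have := hcov v; clear * - this; tauto) h13 h12 (fun h => h23 h.symm) hb i1 i3 i2
  have o23 := h.exists_odd_vertex (x := a₂) (y := a₃) (z := a₁) (by simp; grind)
    (fun v => by have := hcov v; clear * - this; tauto) h23 (fun h => h12 h.symm) (fun h => h13 h.symm) hb i2 i3 i1
  clear hn hn' hcov h4 h
  grind

theorem OneSwap.two_two_case [Finite V] (h : OneSwap G 2) (hE : ∃ a b, G.Adj a b)
    (hnc : ∃ a b, a ≠ b ∧ ¬ G.Adj a b) {a₁ a₂ b₁ b₂ : V} (hn : [a₁, a₂, b₁, b₂].Nodup)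
    (hcov : ∀ v, v = a₁ ∨ v = a₂ ∨ v = b₁ ∨ v = b₂)
    (ha : ¬ G.Adj a₁ a₂) (hb : ¬ G.Adj b₁ b₂) :
    ((∃ t : ℕ, 2 ≤ t ∧ Nonempty (G ≃g completeBipartiteGraph (Fin 1) (Fin t))) ∨
    (∃ r : ℕ, 1 ≤ r ∧
      Nonempty (G ≃g (SimpleGraph.pathGraph 3 ⊕g SimpleGraph.emptyGraph (Fin r)))) ∨
    (∃ r : ℕ, 1 ≤ r ∧
      Nonempty (G ≃g (SimpleGraph.completeGraph (Fin 2) ⊕g SimpleGraph.emptyGraph (Fin r))))) ∨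
    Nonempty (G ≃g SimpleGraph.pathGraph 4) ∨ Nonempty (G ≃g SimpleGraph.cycleGraph 4) ∨
    Nonempty (G ≃g (SimpleGraph.completeGraph (Fin 2) ⊕g SimpleGraph.completeGraph (Fin 2))) := by
  have edge : ∀ u v, G.Adj u v → (G.Adj a₁ b₁ ∧ (u = a₁ ∧ v = b₁ ∨ u = b₁ ∧ v = a₁)) ∨
      (G.Adj a₁ b₂ ∧ (u = a₁ ∧ v = b₂ ∨ u = b₂ ∧ v = a₁)) ∨
      (G.Adj a₂ b₁ ∧ (u = a₂ ∧ v = b₁ ∨ u = b₁ ∧ v = a₂)) ∨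
      (G.Adj a₂ b₂ ∧ (u = a₂ ∧ v = b₂ ∨ u = b₂ ∧ v = a₂)) := by
    intro u v huv
    have := huv.symm
    have := huv.ne
    rcases hcov u with rfl | rfl | rfl | rfl <;>
      rcases hcov v with rfl | rfl | rfl | rfl <;> grind
  by_cases i1 : G.Adj a₁ b₁ ∨ G.Adj a₁ b₂
  swap
  · exact .inl (h.star_case (v := a₂) (fun u v huv => by have := edge u v huv; grind) hE hnc)
  by_cases i2 : G.Adj a₂ b₁ ∨ G.Adj a₂ b₂
  swap
  · exact .inl (h.star_case (v := a₁) (fun u v huv => by have := edge u v huv; grind) hE hnc)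
  by_cases j1 : G.Adj a₁ b₁ ∨ G.Adj a₂ b₁
  swap
  · exact .inl (h.star_case (v := b₂) (fun u v huv => by have := edge u v huv; grind) hE hnc)
  by_cases j2 : G.Adj a₁ b₂ ∨ G.Adj a₂ b₂
  swap
  · exact .inl (h.star_case (v := b₁) (fun u v huv => by have := edge u v huv; grind) hE hnc)
  right
  rcases exists_embedding_two_by_two hn ha hb i1 i2 j1 j2 with ⟨e, he⟩ | ⟨e, he⟩ | ⟨e, he⟩
  · exact .inl (nonempty_iso_of_surjective e fun v => by rw [he]; exact hcov v)
  · exact .inr (.inl (nonempty_iso_of_surjective e fun v => by rw [he]; exact hcov v))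
  · exact .inr (.inr (nonempty_iso_of_surjective e fun v => by rw [he]; exact hcov v))

theorem NoFourfoldColour.card_le [Fintype V] (h4 : NoFourfoldColour G k) {f : V → Fin k}
    (hf : IsProper G f) (i : Fin k) : (Finset.univ.filter (f · = i)).card ≤ 3 := by
  by_contra! hc
  obtain ⟨e⟩ := Function.Embedding.nonempty_of_card_le (α := Fin 4)
    (β := Finset.univ.filter (f · = i))
    (by rw [Fintype.card_fin, Fintype.card_coe]; exact hc)
  have he : ∀ j, f (e j) = i := fun j => (Finset.mem_filter.1 (e j).2).2
  have hne : ∀ j l, j ≠ l → (e j : V) ≠ e l := fun j l hjl h => hjl (e.injective (Subtype.ext h))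
  refine h4 f hf (p := e 0) (q := e 1) (r := e 2) (s := e 3) ?_ (by simp [he]) (by simp [he])
    (by simp [he])
  simp [hne]

/-- The six-vertex bipartite graphs all of whose bipartitions are balanced. -/
theorem NoFourfoldColour.three_three_case [Fintype V] (h4 : NoFourfoldColour G 2) {f : V → Fin 2}
    (hf : IsProper G f) (h0 : (Finset.univ.filter (f · = 0)).card = 3)
    (h1 : (Finset.univ.filter (f · = 1)).card = 3) :
    (Fintype.card V = 6 ∧ G.Connected ∧
      ∃ X Y : Set V, G.IsBipartiteWith X Y ∧ X.ncard = 3 ∧ Y.ncard = 3) ∨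
    Nonempty (G ≃g (SimpleGraph.pathGraph 4 ⊕g SimpleGraph.completeGraph (Fin 2))) ∨
    Nonempty (G ≃g (SimpleGraph.cycleGraph 4 ⊕g SimpleGraph.completeGraph (Fin 2))) ∨
    Nonempty (G ≃g ((SimpleGraph.completeGraph (Fin 2) ⊕g SimpleGraph.completeGraph (Fin 2)) ⊕g
        SimpleGraph.completeGraph (Fin 2))) := by
  classical
  have hfil : (Finset.univ.filter (f · ≠ 0)) = Finset.univ.filter (f · = 1) := by
    ext v; simp; omega
  by_cases hconn : G.Connected
  · refine .inl ⟨?_, hconn, {v | f v = 0}, {v | f v = 1}, ⟨?_, ?_⟩, ?_, ?_⟩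
    · have := Finset.card_filter_add_card_filter_not (s := (Finset.univ : Finset V)) (f · = 0)
      rw [← Finset.card_univ]
      simp only [← ne_eq] at this
      rw [hfil] at this
      omega
    · rw [Set.disjoint_left]
      intro v hv hv'
      simp_all
    · intro u v huv
      have := hf huv
      simp
      omega
    · rw [← h0, Set.ncard_eq_toFinset_card']
      simp
    · rw [← h1, Set.ncard_eq_toFinset_card']
      simp
  right
  -- An isolated vertex could move to the other class and make it have four vertices.
  have niso : ∀ w, ∃ u, G.Adj w u := by
    intro w
    by_contra! hw
    obtain ⟨j, hj⟩ : ∃ j : Fin 2, f w ≠ j := ⟨1 - f w, by omega⟩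
    have hg := hf.update (a := w) (i := j) (fun u hu => (hw u hu).elim)
    have := h4.card_le hg j
    have heq : Finset.univ.filter (fun v => (if v = w then j else f v) = j) =
        insert w (Finset.univ.filter (f · = j)) := by
      ext v; simp; grind
    have h2 : (Finset.univ.filter (f · = j)).card = 3 := by
      have : j = 0 ∨ j = 1 := by omega
      rcases this with rfl | rfl <;> assumption
    rw [heq, Finset.card_insert_of_notMem (by simpa using hj), h2] at this
    omega
  obtain ⟨U, hU, ⟨v₀, hv₀⟩, v₁, hv₁⟩ : ∃ U : V → Prop, (∀ u v, G.Adj u v → (U u ↔ U v)) ∧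
      (∃ v, U v) ∧ ∃ v, ¬ U v := by
    obtain ⟨v₀, hv₀⟩ : ∃ v, f v = 0 := by
      obtain ⟨v, hv⟩ := Finset.card_pos.1 (by omega : 0 < (Finset.univ.filter (f · = 0)).card)
      exact ⟨v, by simpa using hv⟩
    refine ⟨fun v => G.Reachable v₀ v, fun u v huv => ⟨fun h => h.trans huv.reachable,
      fun h => h.trans huv.symm.reachable⟩, ⟨v₀, SimpleGraph.Reachable.refl _⟩, ?_⟩
    by_contra! hall
    exact hconn (SimpleGraph.connected_iff_exists_forall_reachable G |>.2 ⟨v₀, hall⟩)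
  have main : ∀ (U : V → Prop), (∀ u v, G.Adj u v → (U u ↔ U v)) →
      (Finset.univ.filter (fun v => f v = 0 ∧ U v)).card = 1 →
      (Finset.univ.filter (fun v => f v = 1 ∧ U v)).card = 1 →
      (Finset.univ.filter (fun v => f v = 0 ∧ ¬ U v)).card = 2 →
      (Finset.univ.filter (fun v => f v = 1 ∧ ¬ U v)).card = 2 →
      Nonempty (G ≃g (SimpleGraph.pathGraph 4 ⊕g SimpleGraph.completeGraph (Fin 2))) ∨
      Nonempty (G ≃g (SimpleGraph.cycleGraph 4 ⊕g SimpleGraph.completeGraph (Fin 2))) ∨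
      Nonempty (G ≃g ((SimpleGraph.completeGraph (Fin 2) ⊕g
        SimpleGraph.completeGraph (Fin 2)) ⊕g SimpleGraph.completeGraph (Fin 2))) := by
    intro U hU c1 c2 c3 c4
    obtain ⟨a, ha⟩ := Finset.card_eq_one.1 c1
    obtain ⟨b, hb⟩ := Finset.card_eq_one.1 c2
    obtain ⟨a₁, a₂, haa, ha'⟩ := Finset.card_eq_two.1 c3
    obtain ⟨b₁, b₂, hbb, hb'⟩ := Finset.card_eq_two.1 c4
    simp only [Finset.ext_iff, Finset.mem_filter, Finset.mem_univ, true_and,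
      Finset.mem_singleton, Finset.mem_insert] at ha hb ha' hb'
    have hcov : ∀ v, (v = a₁ ∨ v = a₂ ∨ v = b₁ ∨ v = b₂) ∨ (v = a ∨ v = b) := by
      intro v
      rw [← ha, ← hb]
      have h3 := ha' v
      have h4 := hb' v
      have : f v = 0 ∨ f v = 1 := by omega
      tauto
    have Ha := (ha a).2 rfl
    have Hb := (hb b).2 rfl
    have Ha1 := (ha' a₁).2 (.inl rfl)
    have Ha2 := (ha' a₂).2 (.inr rfl)
    have Hb1 := (hb' b₁).2 (.inl rfl)
    have Hb2 := (hb' b₂).2 (.inr rfl)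
    have nb : ∀ w, ∃ u, G.Adj w u ∧ f u ≠ f w ∧ (U w ↔ U u) := fun w => by
      obtain ⟨u, hu⟩ := niso w
      exact ⟨u, hu, (hf hu).symm, hU _ _ hu⟩
    have one : ∀ x : Fin 2, x ≠ 0 → x = 1 := by omega
    have zero : ∀ x : Fin 2, x ≠ 1 → x = 0 := by omega
    have adj : G.Adj a b := by
      obtain ⟨u, hu, hfu, hUu⟩ := nb a
      rw [Ha.1] at hfu
      have := (hb u).1 ⟨one _ hfu, hUu.1 Ha.2⟩
      exact this ▸ hu
    have adjA : ∀ x, f x = 0 ∧ ¬ U x → G.Adj x b₁ ∨ G.Adj x b₂ := by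
      intro x hx
      obtain ⟨u, hu, hfu, hUu⟩ := nb x
      rw [hx.1] at hfu
      rcases (hb' u).1 ⟨one _ hfu, fun h => hx.2 (hUu.2 h)⟩ with rfl | rfl
      · exact .inl hu
      · exact .inr hu
    have adjB : ∀ x, f x = 1 ∧ ¬ U x → G.Adj a₁ x ∨ G.Adj a₂ x := by
      intro x hx
      obtain ⟨u, hu, hfu, hUu⟩ := nb x
      rw [hx.1] at hfu
      rcases (ha' u).1 ⟨zero _ hfu, fun h => hx.2 (hUu.2 h)⟩ with rfl | rfl
      · exact .inl hu.symm
      · exact .inr hu.symm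
    obtain ⟨e', he'⟩ := exists_embedding_complete_two adj
    have inU : ∀ x ∈ ({a, b} : Set V), U x := by
      rintro x (rfl | rfl)
      exacts [Ha.2, Hb.2]
    have notU : ∀ x ∈ ({a₁, a₂, b₁, b₂} : Set V), ¬ U x := by
      rintro x (rfl | rfl | rfl | rfl)
      exacts [Ha1.2, Ha2.2, Hb1.2, Hb2.2]
    have sum : ∀ {W : Type} {H : SimpleGraph W} (e : H ↪g G), Set.range e = {a₁, a₂, b₁, b₂} →
        Nonempty (G ≃g (H ⊕g SimpleGraph.completeGraph (Fin 2))) := by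
      intro W H e he
      refine nonempty_iso_sum e e' ?_ ?_ ?_
      · rw [he, he']
        rintro x hx y hy rfl
        exact notU x hx (inU x hy)
      · rw [he, he']
        intro x hx y hy hxy
        exact notU x hx ((hU x y hxy).2 (inU y hy))
      · rw [he, he']
        exact hcov
    have hne : ∀ x y, f x = 0 → f y = 1 → x ≠ y := by
      rintro x y hx hy rfl
      simp [hx] at hy
    have hn : [a₁, a₂, b₁, b₂].Nodup := by
      simp [haa, hbb, hne _ _ Ha1.1 Hb1.1, hne _ _ Ha1.1 Hb2.1, hne _ _ Ha2.1 Hb1.1,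
        hne _ _ Ha2.1 Hb2.1]
    rcases exists_embedding_two_by_two hn (fun h => hf h (Ha1.1.trans Ha2.1.symm))
      (fun h => hf h (Hb1.1.trans Hb2.1.symm)) (adjA _ Ha1) (adjA _ Ha2) (adjB _ Hb1)
      (adjB _ Hb2) with ⟨e, he⟩ | ⟨e, he⟩ | ⟨e, he⟩
    · exact .inl (sum e he)
    · exact .inr (.inl (sum e he))
    · exact .inr (.inr (sum e he))
  have split : ∀ i : Fin 2, (Finset.univ.filter (fun v => f v = i ∧ U v)).card +
      (Finset.univ.filter (fun v => f v = i ∧ ¬ U v)).card =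
      (Finset.univ.filter (f · = i)).card := by
    intro i
    have := Finset.card_filter_add_card_filter_not (s := Finset.univ.filter (f · = i)) U
    rwa [Finset.filter_filter, Finset.filter_filter] at this
  -- `U` is a union of components, so its colours may be flipped. Since no class may exceed three
  -- afterwards, `U` contains equally many vertices of each colour, one or two.
  have hg : IsProper G (fun v => if U v then 1 - f v else f v) := by
    intro u v huv
    have := hf huv
    by_cases hu : U u
    · have hv := (hU u v huv).1 hu
      simp only [hu, hv, if_true]
      omega
    · have hv : ¬ U v := fun h => hu ((hU u v huv).2 h)
      simpa only [hu, hv, if_false] using this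
  have cross : ∀ i : Fin 2, (Finset.univ.filter (fun v => f v = 1 - i ∧ U v)).card +
      (Finset.univ.filter (fun v => f v = i ∧ ¬ U v)).card ≤ 3 := by
    intro i
    have := h4.card_le hg i
    rwa [← Finset.card_filter_add_card_filter_not U, Finset.filter_filter, Finset.filter_filter,
      Finset.filter_congr (q := fun v => f v = 1 - i ∧ U v) (by intro v _; by_cases hv : U v <;> simp [hv]; omega),
      Finset.filter_congr (p := fun v => _ ∧ ¬ U v) (q := fun v => f v = i ∧ ¬ U v)
        (by intro v _; by_cases hv : U v <;> simp [hv])] at this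
  have s0 := split 0
  have s1 := split 1
  have c0 := cross 0
  have c1 := cross 1
  simp only [sub_zero, sub_self] at c0 c1
  rw [h0] at s0
  rw [h1] at s1
  have pos : 0 < (Finset.univ.filter (fun v => f v = 0 ∧ U v)).card +
      (Finset.univ.filter (fun v => f v = 1 ∧ U v)).card := by
    have hv : f v₀ = 0 ∨ f v₀ = 1 := by omega
    rcases hv with hv | hv
    · have := Finset.card_pos.2 (⟨v₀, by simp [hv, hv₀]⟩ :
        (Finset.univ.filter (fun v => f v = 0 ∧ U v)).Nonempty)
      omega
    · have := Finset.card_pos.2 (⟨v₀, by simp [hv, hv₀]⟩ :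
        (Finset.univ.filter (fun v => f v = 1 ∧ U v)).Nonempty)
      omega
  have pos' : 0 < (Finset.univ.filter (fun v => f v = 0 ∧ ¬ U v)).card +
      (Finset.univ.filter (fun v => f v = 1 ∧ ¬ U v)).card := by
    have hv : f v₁ = 0 ∨ f v₁ = 1 := by omega
    rcases hv with hv | hv
    · have := Finset.card_pos.2 (⟨v₁, by simp [hv, hv₁]⟩ :
        (Finset.univ.filter (fun v => f v = 0 ∧ ¬ U v)).Nonempty)
      omega
    · have := Finset.card_pos.2 (⟨v₁, by simp [hv, hv₁]⟩ :
        (Finset.univ.filter (fun v => f v = 1 ∧ ¬ U v)).Nonempty)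
      omega
  by_cases hm : (Finset.univ.filter (fun v => f v = 0 ∧ U v)).card = 1
  · exact main U hU hm (by omega) (by omega) (by omega)
  · exact main (fun v => ¬ U v) (fun u v huv => not_congr (hU u v huv))
      (by convert (by omega : (Finset.univ.filter (fun v => f v = 0 ∧ ¬ U v)).card = 1))
      (by convert (by omega : (Finset.univ.filter (fun v => f v = 1 ∧ ¬ U v)).card = 1))
      (by simp only [not_not]; omega) (by simp only [not_not]; omega)

/-- The bipartite graphs in whose bipartitions one class has at most two vertices. -/
theorem OneSwap.small_class_case [Fintype V] (h : OneSwap G 2) (hs : AllSurjective G 2)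
    (h4 : NoFourfoldColour G 2) {f : V → Fin 2} (hf : IsProper G f) (hE : ∃ a b, G.Adj a b)
    (hnc : ∃ a b, a ≠ b ∧ ¬ G.Adj a b) {i j : Fin 2} (hij : i ≠ j)
    (hji : (Finset.univ.filter (f · = j)).card ≤ (Finset.univ.filter (f · = i)).card)
    (hj3 : (Finset.univ.filter (f · = j)).card ≠ 3) :
    ((∃ t : ℕ, 2 ≤ t ∧ Nonempty (G ≃g completeBipartiteGraph (Fin 1) (Fin t))) ∨
    (∃ r : ℕ, 1 ≤ r ∧
      Nonempty (G ≃g (SimpleGraph.pathGraph 3 ⊕g SimpleGraph.emptyGraph (Fin r)))) ∨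
    (∃ r : ℕ, 1 ≤ r ∧
      Nonempty (G ≃g (SimpleGraph.completeGraph (Fin 2) ⊕g SimpleGraph.emptyGraph (Fin r))))) ∨
    (Nonempty (G ≃g SimpleGraph.pathGraph 4) ∨ Nonempty (G ≃g SimpleGraph.cycleGraph 4) ∨
    Nonempty (G ≃g (SimpleGraph.completeGraph (Fin 2) ⊕g SimpleGraph.completeGraph (Fin 2)))) ∨
    (Nonempty (G ≃g (SimpleGraph.pathGraph 4 ⊕g SimpleGraph.completeGraph (Fin 1))) ∨
    Nonempty (G ≃g (SimpleGraph.cycleGraph 4 ⊕g SimpleGraph.completeGraph (Fin 1))) ∨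
    Nonempty (G ≃g ((SimpleGraph.completeGraph (Fin 2) ⊕g SimpleGraph.completeGraph (Fin 2)) ⊕g
        SimpleGraph.completeGraph (Fin 1)))) := by
  classical
  have hpos : 0 < (Finset.univ.filter (f · = j)).card := by
    obtain ⟨v, hv⟩ := hs f hf j
    exact Finset.card_pos.2 ⟨v, by simpa using hv⟩
  have hind : ∀ i u v, f u = i → f v = i → ¬ G.Adj u v := fun i u v hu hv huv =>
    hf huv (hu.trans hv.symm)
  have hcol : ∀ v, f v = i ∨ f v = j := by omega
  have hne : ∀ u v, f u = i → f v = j → u ≠ v := by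
    rintro u v hu hv rfl
    exact hij (hu.symm.trans hv)
  have hi := h4.card_le hf i
  have hj := h4.card_le hf j
  by_cases hj1 : (Finset.univ.filter (f · = j)).card = 1
  · obtain ⟨v, hv⟩ := Finset.card_eq_one.1 hj1
    simp only [Finset.ext_iff, Finset.mem_filter, Finset.mem_univ, true_and,
      Finset.mem_singleton] at hv
    refine Or.inl (h.star_case (v := v) (fun a b hab => ?_) hE hnc)
    rw [← hv, ← hv]
    have := hf hab
    have := hcol a
    have := hcol b
    grind
  have hj2 : (Finset.univ.filter (f · = j)).card = 2 := by omega
  obtain ⟨b₁, b₂, hbb, hb⟩ := Finset.card_eq_two.1 hj2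
  simp only [Finset.ext_iff, Finset.mem_filter, Finset.mem_univ, true_and,
    Finset.mem_singleton, Finset.mem_insert] at hb
  have fb₁ := (hb b₁).2 (.inl rfl)
  have fb₂ := (hb b₂).2 (.inr rfl)
  by_cases hi2 : (Finset.univ.filter (f · = i)).card = 2
  · obtain ⟨a₁, a₂, haa, ha⟩ := Finset.card_eq_two.1 hi2
    simp only [Finset.ext_iff, Finset.mem_filter, Finset.mem_univ, true_and,
      Finset.mem_singleton, Finset.mem_insert] at ha
    have fa₁ := (ha a₁).2 (.inl rfl)
    have fa₂ := (ha a₂).2 (.inr rfl)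
    refine (h.two_two_case hE hnc (a₁ := a₁) (a₂ := a₂) (b₁ := b₁) (b₂ := b₂)
      ?_ (fun v => ?_) (hind i _ _ fa₁ fa₂) (hind j _ _ fb₁ fb₂)) |>.imp_right .inl
    · simp [haa, hbb, hne _ _ fa₁ fb₁, hne _ _ fa₁ fb₂, hne _ _ fa₂ fb₁, hne _ _ fa₂ fb₂]
    · rw [← or_assoc, ← ha, ← hb]
      exact hcol v
  · have hi3 : (Finset.univ.filter (f · = i)).card = 3 := by omega
    obtain ⟨a₁, a₂, a₃, h12, h13, h23, ha⟩ := Finset.card_eq_three.1 hi3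
    simp only [Finset.ext_iff, Finset.mem_filter, Finset.mem_univ, true_and,
      Finset.mem_singleton, Finset.mem_insert] at ha
    have fa₁ := (ha a₁).2 (.inl rfl)
    have fa₂ := (ha a₂).2 (.inr (.inl rfl))
    have fa₃ := (ha a₃).2 (.inr (.inr rfl))
    refine .inr (.inr (h.three_two_case h4 (a₁ := a₁) (a₂ := a₂) (a₃ := a₃) (b₁ := b₁) (b₂ := b₂)
      ?_ (fun v => ?_) (hind i _ _ fa₁ fa₂) (hind i _ _ fa₁ fa₃) (hind i _ _ fa₂ fa₃)
      (hind j _ _ fb₁ fb₂)))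
    · simp [h12, h13, h23, hbb, hne _ _ fa₁ fb₁, hne _ _ fa₁ fb₂, hne _ _ fa₂ fb₁,
        hne _ _ fa₂ fb₂, hne _ _ fa₃ fb₁, hne _ _ fa₃ fb₂]
    · have h5 := ha v
      have h6 := hb v
      have h7 := hcol v
      clear * - h5 h6 h7
      tauto

end OneSwap

/-! ### From villainy two to exchanges, and the final case distinction. -/

/-- The permutations of optimal colourings of a graph of villainy two become proper after one
exchange of colours. -/
theorem oneSwap_of_villainy_eq_two {V : Type*} [Finite V] {G : SimpleGraph V}
    (hG : villainy G = 2) : OneSwap G G.chromaticNumber.toNat := by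
  intro f hf σ
  let F : G.Coloring (Fin G.chromaticNumber.toNat) := SimpleGraph.Coloring.mk f fun h => hf h
  have hle : coloringVillainy G (fun v => F (σ v)) ≤ 2 :=
    hG ▸ (villainy_isGreatest G).2 ⟨F, σ, rfl⟩
  obtain ⟨g, hg, hm⟩ := (coloringVillainy_isLeast G F σ).1
  rw [hm] at hle
  set c : V → Fin G.chromaticNumber.toNat := fun v => F (σ v) with hc
  have hprop : IsProper G g := fun u v huv => g.valid huv
  -- The colour lost at `x` must be gained elsewhere, because multiplicities agree. With at most two
  -- changes this is an exchange.
  have swap : ∀ x, g x ≠ c x → ∃ y, y ≠ x ∧ g y ≠ c y ∧ g y = c x := by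
    intro x hx
    by_contra! hno
    have hlt : {v | g v = c x}.ncard < {v | c v = c x}.ncard := by
      refine Set.ncard_lt_ncard ⟨fun y hy => ?_, fun hsub => hx (hsub (a := x) rfl)⟩
      have hyx : y ≠ x := by rintro rfl; exact hx hy
      by_contra hcy
      exact hno y hyx (fun he => hcy (he.symm.trans hy)) hy
    exact hlt.ne (hg (c x))
  by_cases hne : ∃ x, g x ≠ c x
  · obtain ⟨x, hx⟩ := hne
    obtain ⟨y, hyx, hy, hgy⟩ := swap x hx
    have hcov : ∀ w, g w ≠ c w → w = x ∨ w = y := by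
      intro w hw
      by_contra! hwn
      have hsub : ({x, y, w} : Set V) ⊆ {v | g v ≠ c v} := by
        rintro v (rfl | rfl | rfl) <;> assumption
      have := Set.ncard_le_ncard hsub
      rw [Set.ncard_eq_three.2 ⟨x, y, w, hyx.symm, hwn.1.symm, hwn.2.symm, rfl⟩] at this
      omega
    obtain ⟨z, hzy, hz, hgz⟩ := swap y hy
    obtain rfl : z = x := (hcov z hz).resolve_right hzy
    refine ⟨z, y, g, hgz, hgy, fun w => ?_, hprop⟩
    by_contra! hw
    exact (hcov w hw.2.2).elim hw.1 hw.2.1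
  · push Not at hne
    -- The trivial exchange `x = y` needs a vertex; the empty graph has villainy 0.
    by_cases hV : Nonempty V
    · obtain ⟨x⟩ := hV
      exact ⟨x, x, g, hne x, hne x, fun w => .inr (.inr (hne w)), hprop⟩
    · exfalso
      have hz : ∀ m ∈ villainySet G, m = 0 := by
        rintro m ⟨f, τ, rfl⟩
        obtain ⟨g', -, hm'⟩ := (coloringVillainy_isLeast G f τ).1
        rw [hm', Set.ncard_eq_zero]
        ext v
        exact (hV ⟨v⟩).elim
      simpa [hG] using hz _ (villainy_isGreatest G).1

/-- A permuted colouring without monochromatic edges is its own repair, at cost 0. The conflict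
provides both an edge and a repeated colour. -/
theorem exists_conflict_of_villainy_ne_zero {V : Type*} [Finite V] {G : SimpleGraph V}
    (hG : villainy G ≠ 0) : ∃ f : V → Fin G.chromaticNumber.toNat, IsProper G f ∧
      ∃ (σ : Equiv.Perm V) (u v : V), G.Adj u v ∧ f (σ u) = f (σ v) := by
  by_contra! hc
  obtain ⟨f, σ, hm⟩ := (villainy_isGreatest G).1
  refine hG (hm.trans (Nat.le_zero.1 ((coloringVillainy_isLeast G f σ).2 ?_)))
  refine ⟨SimpleGraph.Coloring.mk (fun v => f (σ v)) fun {u v} h =>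
    hc f (fun u v h => f.valid h) σ u v h, fun i => rfl, ?_⟩
  symm
  rw [Set.ncard_eq_zero]
  exact Set.eq_empty_of_forall_notMem fun v hv => hv rfl

theorem allSurjective_chromaticNumber {V : Type*} [Finite V] (G : SimpleGraph V) :
    AllSurjective G G.chromaticNumber.toNat := by
  intro f hf
  have := Fintype.ofFinite V
  have hne : G.chromaticNumber ≠ ⊤ :=
    SimpleGraph.chromaticNumber_ne_top_iff_exists.2 ⟨_, G.colorable_of_fintype⟩
  exact SimpleGraph.le_chromaticNumber_iff_forall_surjective.1
    (ENat.natCast_toNat hne).le (SimpleGraph.Coloring.mk f fun h => hf h)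

theorem theorem1 {V : Type*} [Fintype V] (G : SimpleGraph V) [DecidableRel G.Adj]
    (hG : villainy G = 2) :
    -- a star `K_{1,t}` with `t ≥ 2`
    (∃ t : ℕ, 2 ≤ t ∧ Nonempty (G ≃g completeBipartiteGraph (Fin 1) (Fin t))) ∨
    -- a 6-vertex connected bipartite graph with parts of size 3
    (Fintype.card V = 6 ∧ G.Connected ∧
      ∃ X Y : Set V, G.IsBipartiteWith X Y ∧ X.ncard = 3 ∧ Y.ncard = 3) ∨
    -- `P_4`, `P_4 + K_1`, `P_4 + K_2`
    (Nonempty (G ≃g SimpleGraph.pathGraph 4) ∨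
      Nonempty (G ≃g (SimpleGraph.pathGraph 4 ⊕g SimpleGraph.completeGraph (Fin 1))) ∨
      Nonempty (G ≃g (SimpleGraph.pathGraph 4 ⊕g SimpleGraph.completeGraph (Fin 2)))) ∨
    -- `C_4`, `C_4 + K_1`, `C_4 + K_2`
    (Nonempty (G ≃g SimpleGraph.cycleGraph 4) ∨
      Nonempty (G ≃g (SimpleGraph.cycleGraph 4 ⊕g SimpleGraph.completeGraph (Fin 1))) ∨
      Nonempty (G ≃g (SimpleGraph.cycleGraph 4 ⊕g SimpleGraph.completeGraph (Fin 2)))) ∨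
    -- `C_5`
    Nonempty (G ≃g SimpleGraph.cycleGraph 5) ∨
    -- `K_2 + K_2`, `K_2 + K_2 + K_2`
    (Nonempty (G ≃g (SimpleGraph.completeGraph (Fin 2) ⊕g SimpleGraph.completeGraph (Fin 2))) ∨
      Nonempty (G ≃g ((SimpleGraph.completeGraph (Fin 2) ⊕g SimpleGraph.completeGraph (Fin 2)) ⊕g
        SimpleGraph.completeGraph (Fin 2)))) ∨
    -- `K_3 + K_2`
    Nonempty (G ≃g (SimpleGraph.completeGraph (Fin 3) ⊕g SimpleGraph.completeGraph (Fin 2))) ∨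
    -- `K_3 + K_3`
    Nonempty (G ≃g (SimpleGraph.completeGraph (Fin 3) ⊕g SimpleGraph.completeGraph (Fin 3))) ∨
    -- `K_2 + K_2 + K_1`
    Nonempty (G ≃g ((SimpleGraph.completeGraph (Fin 2) ⊕g SimpleGraph.completeGraph (Fin 2)) ⊕g
      SimpleGraph.completeGraph (Fin 1))) ∨
    -- order at least 4, with a vertex of degree 0 or 1 whose deletion leaves a complete graph
    (4 ≤ Fintype.card V ∧
      ∃ v : V, (G.degree v = 0 ∨ G.degree v = 1) ∧
        G.induce {v}ᶜ = SimpleGraph.completeGraph ({v}ᶜ : Set V)) ∨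
    -- `P_3 + r K_1` with `r ≥ 1`
    (∃ r : ℕ, 1 ≤ r ∧
      Nonempty (G ≃g (SimpleGraph.pathGraph 3 ⊕g SimpleGraph.emptyGraph (Fin r)))) ∨
    -- `K_2 + r K_1` with `r ≥ 1`
    (∃ r : ℕ, 1 ≤ r ∧
      Nonempty (G ≃g (SimpleGraph.completeGraph (Fin 2) ⊕g SimpleGraph.emptyGraph (Fin r)))) := by
  classical
  have h := oneSwap_of_villainy_eq_two hG
  have hs := allSurjective_chromaticNumber G
  obtain ⟨f, hf, σ, u, v, huv, hfuv⟩ := exists_conflict_of_villainy_ne_zero (G := G) (by omega)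
  generalize G.chromaticNumber.toNat = k at *
  have hE : ∃ a b, G.Adj a b := ⟨u, v, huv⟩
  have hp : σ u ≠ σ v := fun h => huv.ne (σ.injective h)
  have hnc : ∃ a b, a ≠ b ∧ ¬ G.Adj a b := ⟨σ u, σ v, hp, fun h => hf h hfuv⟩
  have hk : k = 2 ∨ 3 ≤ k := by
    have := hf huv
    omega
  by_cases h4 : NoFourfoldColour G k
  · rcases hk with rfl | hk
    · by_cases h33 : (Finset.univ.filter (f · = 0)).card = 3 ∧
          (Finset.univ.filter (f · = 1)).card = 3
      · rcases h4.three_three_case hf h33.1 h33.2 with h | h | h | h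
        · exact .inr (.inl h)
        · exact .inr (.inr (.inl (.inr (.inr h))))
        · exact .inr (.inr (.inr (.inl (.inr (.inr h)))))
        · exact .inr (.inr (.inr (.inr (.inr (.inl (.inr h))))))
      · have h0 := h4.card_le hf 0
        have h1 := h4.card_le hf 1
        obtain ⟨i, j, hij, hji, hj3⟩ : ∃ i j : Fin 2, i ≠ j ∧
            (Finset.univ.filter (f · = j)).card ≤ (Finset.univ.filter (f · = i)).card ∧
            (Finset.univ.filter (f · = j)).card ≠ 3 := by
          rcases le_total (Finset.univ.filter (f · = 1)).card
            (Finset.univ.filter (f · = 0)).card with hle | hle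
          · exact ⟨0, 1, by decide, hle, by omega⟩
          · exact ⟨1, 0, by decide, hle, by omega⟩
        rcases h.small_class_case hs h4 hf hE hnc hij hji hj3 with
          (h | h | h) | (h | h | h) | h | h | h
        · exact .inl h
        · exact .inr (.inr (.inr (.inr (.inr (.inr (.inr (.inr (.inr (.inr (.inl h))))))))))
        · exact .inr (.inr (.inr (.inr (.inr (.inr (.inr (.inr (.inr (.inr (.inr h))))))))))
        · exact .inr (.inr (.inl (.inl h)))
        · exact .inr (.inr (.inr (.inl (.inl h))))
        · exact .inr (.inr (.inr (.inr (.inr (.inl (.inl h))))))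
        · exact .inr (.inr (.inl (.inr (.inl h))))
        · exact .inr (.inr (.inr (.inl (.inr (.inl h)))))
        · exact .inr (.inr (.inr (.inr (.inr (.inr (.inr (.inr (.inl h))))))))
    · by_cases hone : ∀ g : V → Fin k, IsProper G g → ∀ p p' q q', p ≠ p' → q ≠ q' →
          g p = g p' → g q = g q' → g p = g q
      · obtain ⟨w, hw, hw'⟩ := h.almost_complete hs hk hone hf hp hfuv
        -- With at most three vertices, surjectivity onto at least three colours would make `f`
        -- injective, yet it repeats a colour.
        have hcard : 4 ≤ Fintype.card V := by
          by_contra! hlt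
          have := Fintype.card_le_of_surjective f (hs f hf)
          rw [Fintype.card_fin] at this
          have hbij := (Fintype.bijective_iff_surjective_and_card f).2
            ⟨hs f hf, by rw [Fintype.card_fin]; omega⟩
          exact hp (hbij.1 hfuv)
        have hdeg : G.degree w ≤ 1 := by
          refine Finset.card_le_one.2 fun a ha b hb => hw' a b ?_ ?_
          · simpa using ha
          · simpa using hb
        have hcomp : G.induce {w}ᶜ = SimpleGraph.completeGraph ({w}ᶜ : Set V) := by
          ext ⟨a, ha⟩ ⟨b, hb⟩
          simp only [SimpleGraph.comap_adj, Function.Embedding.subtype_apply,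
            SimpleGraph.completeGraph_eq_top, SimpleGraph.top_adj, ne_eq, Subtype.mk.injEq]
          exact ⟨fun hab => hab.ne, fun hab => hw a b ha hb hab⟩
        have h : 4 ≤ Fintype.card V ∧ ∃ v : V, (G.degree v = 0 ∨ G.degree v = 1) ∧
            G.induce {v}ᶜ = SimpleGraph.completeGraph ({v}ᶜ : Set V) :=
          ⟨hcard, w, by omega, hcomp⟩
        exact .inr (.inr (.inr (.inr (.inr (.inr (.inr (.inr (.inr (.inl h)))))))))
      · push Not at hone
        obtain ⟨g, hg, p, p', q, q', hpp, hqq, h1, h2, hpq⟩ := hone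
        by_cases hT : NoTriangle G
        · have h := h.triangle_free_case hs hk hT hg hpp hqq h1 h2 hpq
          exact .inr (.inr (.inr (.inr (.inl h))))
        · simp only [NoTriangle, not_forall] at hT
          obtain ⟨a, b, c, hab, hac, hbc, -⟩ := hT
          rcases h.triangle_case hs hk hg hpp hqq h1 h2 hpq hab hac hbc with h | h
          · exact .inr (.inr (.inr (.inr (.inr (.inr (.inl h))))))
          · exact .inr (.inr (.inr (.inr (.inr (.inr (.inr (.inl h)))))))
  · simp only [NoFourfoldColour, not_forall] at h4
    obtain ⟨g, hg, p, q, r, s, hn, h1, h2, h3, -⟩ := h4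
    have hM : ∀ ⦃a b c d⦄, [a, b, c, d].Nodup → G.Adj a b → G.Adj c d → False :=
      fun a b c d hm hab hcd => h.no_two_matching hg hn h1 h2 h3 hm hab hcd
    have hT : NoTriangle G := fun a b c hab hac hbc =>
      h.no_triangle hg (p := p) (q := q) (r := r) (by simp at hn ⊢; grind) h1 h2 hab hac hbc
    obtain ⟨w, hw⟩ := exists_center hT hM huv
    rcases hk with rfl | hk
    · rcases h.star_case hw hE hnc with h | h | h
      · exact .inl h
      · exact .inr (.inr (.inr (.inr (.inr (.inr (.inr (.inr (.inr (.inr (.inl h))))))))))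
      · exact .inr (.inr (.inr (.inr (.inr (.inr (.inr (.inr (.inr (.inr (.inr h))))))))))
    · refine (hs.not_bipartite hk (· = w) fun a b hab => ?_).elim
      have := hw hab
      have := hab.ne
      grind
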